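/- Let $n \ge 4$ be an integer, let $F_n$ be the free group of rank $n$ and let $\mathrm{Aut}(F_n)$ be its automorphism group. Let $\lfloor n/3\rfloor$ denote the integer part of $n/3$. For every integer $0\le d \le 2\lfloor n/3\rfloor$, every action of $\mathrm{Aut}(F_n)$ by isometries (not necessarily semisimple) on a non-empty complete $\mathrm{CAT}(0)$ space $X$ of covering dimension $d$ has a global fixed point, i.e. there is $x\in X$ with $gx=x$ for all $g\in \mathrm{Aut}(F_n)$. In particular, $\mathrm{Aut}(F_n)$ has property $\mathcal{FA}_{2\lfloor n/3\rfloor}$, where a group $G$ has property $\mathcal{FA}_m$ if every action of $G$ by isometries on a non-empty complete $\mathrm{CAT}(0)$ space of covering dimension $m$ has a global fixed point. -/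

import Mathlib

/-- `γ`, restricted to `[0, 1]`, is a geodesic from `x` to `y`, parametrized proportionally to
arc length. -/
structure IsGeodesic {X : Type*} [MetricSpace X] (γ : ℝ → X) (x y : X) : Prop where
  map_zero : γ 0 = x
  map_one : γ 1 = y
  dist_eq : ∀ s ∈ Set.Icc (0 : ℝ) 1, ∀ t ∈ Set.Icc (0 : ℝ) 1,
    dist (γ s) (γ t) = |s - t| * dist x y

/-- `X` is a CAT(0) space: a geodesic metric space in which geodesic triangles are at most as
thick as their comparison triangles in the Euclidean plane.

Two points on distinct sides of a geodesic triangle lie on the two sides issuing from a common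
vertex, which is called `x` below (all triples of vertices are quantified over, and a geodesic can
be reversed); for two points on the same side the inequality is an equality. -/
structure IsCAT0 (X : Type*) [MetricSpace X] : Prop where
  exists_geodesic : ∀ x y : X, ∃ γ : ℝ → X, IsGeodesic γ x y
  comparison : ∀ (x y z : X) (γ δ : ℝ → X), IsGeodesic γ x y → IsGeodesic δ x z →
    ∀ x' y' z' : EuclideanSpace ℝ (Fin 2),
      dist x' y' = dist x y → dist y' z' = dist y z → dist x' z' = dist x z →
      ∀ s ∈ Set.Icc (0 : ℝ) 1, ∀ t ∈ Set.Icc (0 : ℝ) 1,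
        dist (γ s) (δ t) ≤ dist (AffineMap.lineMap x' y' s) (AffineMap.lineMap x' z' t)

/-- The (Lebesgue) covering dimension of `X` is at most `d`: every finite open cover has a finite
open refinement, still a cover, such that every point lies in at most `d + 1` of its members. -/
def HasCoveringDimLE (X : Type*) [TopologicalSpace X] (d : ℕ) : Prop :=
  ∀ U : Set (Set X), U.Finite → (∀ u ∈ U, IsOpen u) → ⋃₀ U = Set.univ →
    ∃ V : Set (Set X), V.Finite ∧ (∀ v ∈ V, IsOpen v) ∧ ⋃₀ V = Set.univ ∧
      (∀ v ∈ V, ∃ u ∈ U, v ⊆ u) ∧ ∀ x : X, {v ∈ V | x ∈ v}.encard ≤ d + 1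

/-- The (Lebesgue) covering dimension of the (non-empty) space `X` is equal to `d`. -/
def HasCoveringDim (X : Type*) [TopologicalSpace X] (d : ℕ) : Prop :=
  HasCoveringDimLE X d ∧ ∀ k : ℕ, HasCoveringDimLE X k → d ≤ k

/-- The relative property `FA_d` of a pair `(G, H)`: whenever `G` acts by isometries on a
(non-empty) complete CAT(0) space of dimension `d`, the subgroup `H` has a fixed point. -/
def RelativePropertyFA.{u, v} (G : Type v) [Group G] (H : Subgroup G) (d : ℕ) : Prop :=
  ∀ (X : Type u) [MetricSpace X] [CompleteSpace X] [Nonempty X] [MulAction G X]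
    [IsIsometricSMul G X], IsCAT0 X → HasCoveringDim X d →
    ∃ x : X, ∀ h ∈ H, h • x = x

/-- Property `FA_d` of a group `G`. -/
def PropertyFA.{u, v} (G : Type v) [Group G] (d : ℕ) : Prop :=
  RelativePropertyFA.{u, v} G ⊤ d

universe u

/-! The conclusion is proved for every dimension d ≤ n - 2 (with n ≥ 3), and 2⌊n/3⌋ ≤ n - 2 as soon
as n ≥ 4.

The geometric engine is the Helly-type theorem `IsCAT0.exists_inter_nonempty`. If it failed, points
of the mixed intersections could be placed at the vertices of a cube of dimension N = c * k and
joined by iterated geodesics. Complements of the convex sets then give an open cover whose pullback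
to the cube satisfies Sperner's boundary conditions, so every finite open refinement has N + 1
members with a common point (`HasCoveringDimLE.false_of_cube`), against d < N. Fixed-point sets are
closed and convex, and commuting elliptic sets have a common fixed point. Hence
`IsCAT0.exists_elliptic_of_commuting_families`: fixed points of proper subfamilies bootstrap to a
fixed point of a whole family.

This is applied three times. Pairs of involutions show that x_i ↦ x_j x_i x_j is elliptic, whence
each single transvection is (`elliptic_twist`, `elliptic_lam`). Left and right transvections of many
generators by the same set J then give, by induction on the size of J, a fixed point for all
transvections of one generator by J (`elliptic_rho_finset`). Normalization extends this to
triangular sets of transvections. Finally the transvections of x_b by x_{b+1}, with b cyclic modulo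
n, form n sets; omitting one leaves a triangular set, so since d < n - 1 all of them have a common
fixed point (`elliptic_allTransvections`). They generate all transvections, which are normalized by
inversions and permutations of the generators. Nielsen's theorem `closure_nielsenSet` says that
nothing else is needed. -/

/-! ### CAT(0) geometry: comparison triangles, geodesics, circumcenters. -/

theorem exists_comparison_triangle {a b c : ℝ} (ha : 0 ≤ a) (hb : 0 ≤ b) (hc : 0 ≤ c)
    (habc : a ≤ b + c) (hbac : b ≤ a + c) (hcab : c ≤ a + b) :
    ∃ x y z : EuclideanSpace ℝ (Fin 2), dist x y = a ∧ dist y z = b ∧ dist x z = c := by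
  have key : ∃ u v : ℝ, (a - u) ^ 2 + v ^ 2 = b ^ 2 ∧ u ^ 2 + v ^ 2 = c ^ 2 := by
    rcases ha.eq_or_lt with rfl | ha'
    · have : b = c := by linarith
      exact ⟨c, 0, by rw [this]; ring, by ring⟩
    -- Law of cosines: u is the abscissa of the third vertex when the side of length a lies along
    -- the first axis.
    · set u := (a ^ 2 + c ^ 2 - b ^ 2) / (2 * a) with hu
      have hu' : 2 * a * u = a ^ 2 + c ^ 2 - b ^ 2 := by rw [hu]; field_simp
      have h1 : |u| ≤ c := by
        rw [abs_le]
        constructor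
        · have : 0 ≤ 2 * a * (u + c) := by nlinarith
          nlinarith
        · have : 0 ≤ 2 * a * (c - u) := by nlinarith
          nlinarith
      have h2 : 0 ≤ c ^ 2 - u ^ 2 := by
        have := sq_le_sq' (abs_le.mp h1).1 (abs_le.mp h1).2
        linarith
      refine ⟨u, √(c ^ 2 - u ^ 2), ?_, ?_⟩
      · rw [Real.sq_sqrt h2]; linarith [hu']
      · rw [Real.sq_sqrt h2]; ring
  obtain ⟨u, v, h1, h2⟩ := key
  refine ⟨!₂[0, 0], !₂[a, 0], !₂[u, v], ?_, ?_, ?_⟩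
  · rw [EuclideanSpace.dist_eq]
    simp [Fin.sum_univ_two, Real.dist_eq, Real.sqrt_sq ha]
  · rw [EuclideanSpace.dist_eq]
    simp only [Fin.sum_univ_two, Real.dist_eq, sq_abs]
    simp [h1, Real.sqrt_sq hb]
  · rw [EuclideanSpace.dist_eq]
    simp only [Fin.sum_univ_two, Real.dist_eq, sq_abs]
    simp [h2, Real.sqrt_sq hc]

section Geodesics

variable {X : Type*} [MetricSpace X]

theorem IsGeodesic.reverse {γ : ℝ → X} {x y : X} (h : IsGeodesic γ x y) :
    IsGeodesic (fun s => γ (1 - s)) y x where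
  map_zero := by simpa using h.map_one
  map_one := by simpa using h.map_zero
  dist_eq s hs t ht := by
    rw [h.dist_eq (1 - s) ⟨by linarith [hs.2], by linarith [hs.1]⟩ (1 - t)
      ⟨by linarith [ht.2], by linarith [ht.1]⟩, dist_comm x y,
      show 1 - s - (1 - t) = -(s - t) by ring, abs_neg]

namespace IsCAT0

theorem exists_triangle (x y z : X) : ∃ x' y' z' : EuclideanSpace ℝ (Fin 2),
    dist x' y' = dist x y ∧ dist y' z' = dist y z ∧ dist x' z' = dist x z :=
  exists_comparison_triangle dist_nonneg dist_nonneg dist_nonneg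
    (by rw [dist_comm y z, add_comm]; exact dist_triangle x z y)
    (by rw [dist_comm x y]; exact dist_triangle y x z) (dist_triangle x y z)

theorem dist_le_of_common_source (h : IsCAT0 X) {x y z : X} {γ δ : ℝ → X}
    (hγ : IsGeodesic γ x y) (hδ : IsGeodesic δ x z) {s : ℝ} (hs : s ∈ Set.Icc (0 : ℝ) 1) :
    dist (γ s) (δ s) ≤ s * dist y z := by
  obtain ⟨x', y', z', h1, h2, h3⟩ := exists_triangle x y z
  have := h.comparison x y z γ δ hγ hδ x' y' z' h1 h2 h3 s hs s hs
  rwa [AffineMap.lineMap_apply, AffineMap.lineMap_apply, dist_vadd_cancel_right,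
    vsub_eq_sub, vsub_eq_sub, dist_smul₀, dist_sub_right, Real.norm_of_nonneg hs.1, h2] at this

theorem geodesic_unique (h : IsCAT0 X) {x y : X} {γ δ : ℝ → X}
    (hγ : IsGeodesic γ x y) (hδ : IsGeodesic δ x y) {s : ℝ} (hs : s ∈ Set.Icc (0 : ℝ) 1) :
    γ s = δ s := by
  have := h.dist_le_of_common_source hγ hδ hs
  rw [dist_self, mul_zero] at this
  exact dist_le_zero.mp this

/-- A chosen geodesic from `x` to `y`. -/
noncomputable def geo (h : IsCAT0 X) (x y : X) : ℝ → X :=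
  (h.exists_geodesic x y).choose

theorem isGeodesic_geo (h : IsCAT0 X) (x y : X) : IsGeodesic (h.geo x y) x y :=
  (h.exists_geodesic x y).choose_spec

theorem geo_zero (h : IsCAT0 X) (x y : X) : h.geo x y 0 = x := (h.isGeodesic_geo x y).map_zero

theorem geo_one (h : IsCAT0 X) (x y : X) : h.geo x y 1 = y := (h.isGeodesic_geo x y).map_one

/-- Interpose the diagonal geodesic from `x` to `y'`: it shares its source with one of the two
geodesics and its target with the other. -/
theorem dist_geo_geo_le (h : IsCAT0 X) (x y x' y' : X) {s : ℝ} (hs : s ∈ Set.Icc (0 : ℝ) 1) :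
    dist (h.geo x y s) (h.geo x' y' s) ≤ dist x x' + dist y y' := by
  have h1 := h.dist_le_of_common_source (h.isGeodesic_geo x y) (h.isGeodesic_geo x y') hs
  have h2 := h.dist_le_of_common_source (h.isGeodesic_geo x y').reverse
    (h.isGeodesic_geo x' y').reverse (s := 1 - s) ⟨by linarith [hs.2], by linarith [hs.1]⟩
  simp only [sub_sub_cancel] at h2
  have h3 := dist_triangle (h.geo x y s) (h.geo x y' s) (h.geo x' y' s)
  have h4 : 0 ≤ dist x x' := dist_nonneg
  have h5 : 0 ≤ dist y y' := dist_nonneg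
  nlinarith [hs.1, hs.2]

theorem continuous_geo (h : IsCAT0 X) {Y : Type*} [TopologicalSpace Y] {f g : Y → X}
    {s : Y → unitInterval} (hf : Continuous f) (hg : Continuous g) (hs : Continuous s) :
    Continuous fun p => h.geo (f p) (g p) (s p) := by
  rw [continuous_iff_continuousAt]
  intro p
  rw [ContinuousAt, tendsto_iff_dist_tendsto_zero]
  have hle : ∀ q, dist (h.geo (f q) (g q) (s q)) (h.geo (f p) (g p) (s p)) ≤
      dist (f q) (f p) + dist (g q) (g p) + |(s q : ℝ) - s p| * dist (f p) (g p) := by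
    intro q
    refine (dist_triangle _ (h.geo (f p) (g p) (s q)) _).trans ?_
    rw [(h.isGeodesic_geo (f p) (g p)).dist_eq _ (s q).2 _ (s p).2]
    gcongr
    exact h.dist_geo_geo_le _ _ _ _ (s q).2
  refine squeeze_zero (fun _ => dist_nonneg) hle ?_
  have hc : Continuous fun q =>
      dist (f q) (f p) + dist (g q) (g p) + |(s q : ℝ) - s p| * dist (f p) (g p) := by
    fun_prop
  simpa using hc.tendsto p

/-- The inequality of Bruhat and Tits. -/
theorem dist_midpoint_sq_le (h : IsCAT0 X) (p x y : X) :
    dist p (h.geo x y (1 / 2)) ^ 2 ≤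
      dist p x ^ 2 / 2 + dist p y ^ 2 / 2 - dist x y ^ 2 / 4 := by
  obtain ⟨x', y', z', h1, h2, h3⟩ := exists_triangle x y p
  have := h.comparison x y p _ _ (h.isGeodesic_geo x y) (h.isGeodesic_geo x p) x' y' z' h1 h2 h3
    (1 / 2) ⟨by norm_num, by norm_num⟩ 1 ⟨by norm_num, le_rfl⟩
  rw [geo_one, AffineMap.lineMap_apply_one] at this
  have e : dist (AffineMap.lineMap x' y' (1 / 2 : ℝ)) z' ^ 2 =
      dist z' x' ^ 2 / 2 + dist z' y' ^ 2 / 2 - dist x' y' ^ 2 / 4 := by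
    have e1 := parallelogram_law_with_norm ℝ (z' - x') (z' - y')
    have e2 : AffineMap.lineMap x' y' (1 / 2 : ℝ) - z' =
        (-(1 / 2) : ℝ) • ((z' - x') + (z' - y')) := by
      rw [AffineMap.lineMap_apply_module]
      module
    rw [dist_eq_norm _ z', e2, norm_smul, dist_eq_norm z' x', dist_eq_norm z' y', dist_comm x' y',
      dist_eq_norm y' x']
    rw [show (z' - x') - (z' - y') = y' - x' by abel] at e1
    rw [mul_pow]
    norm_num
    linarith
  rw [dist_comm p x, dist_comm p y, ← h1, ← h2, ← h3, dist_comm x' z', dist_comm y' z', ← e,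
    dist_comm p]
  gcongr

end IsCAT0

/-- A bounded subset of a complete CAT(0) space has a circumcenter, fixed by all isometries that
preserve the subset. -/
theorem IsCAT0.exists_circumcenter [CompleteSpace X] (h : IsCAT0 X) {A : Set X}
    (hA : A.Nonempty) (hb : Bornology.IsBounded A) :
    ∃ x : X, ∀ f : X → X, Isometry f → f '' A = A → f x = x := by
  obtain ⟨a₀, ha₀⟩ := hA
  have : Nonempty A := ⟨⟨a₀, ha₀⟩⟩
  set r : X → ℝ := fun x => ⨆ a : A, dist x a with hr
  have hbdd : ∀ x : X, BddAbove (Set.range fun a : A => dist x a) := by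
    intro x
    obtain ⟨R, hR⟩ := hb.subset_closedBall x
    refine ⟨R, ?_⟩
    rintro _ ⟨a, rfl⟩
    have := hR a.2
    rwa [Metric.mem_closedBall, dist_comm] at this
  have hle : ∀ x, ∀ a ∈ A, dist x a ≤ r x := fun x a ha => le_ciSup (hbdd x) ⟨a, ha⟩
  have hr0 : ∀ x, 0 ≤ r x := fun x => dist_nonneg.trans (hle x a₀ ha₀)
  have hrbdd : BddBelow (Set.range r) := ⟨0, by rintro _ ⟨x, rfl⟩; exact hr0 x⟩
  have : Nonempty X := ⟨a₀⟩
  set R := ⨅ x, r x with hR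
  have hR0 : 0 ≤ R := le_ciInf hr0
  have hRle : ∀ x, R ≤ r x := fun x => ciInf_le hrbdd x
  -- The midpoint has radius at least R, so the Bruhat–Tits inequality forces points of almost
  -- minimal radius to be close. This yields both convergence of a minimizing sequence and
  -- uniqueness of the limit.
  have key : ∀ x y, dist x y ^ 2 ≤ 2 * (r x ^ 2 + r y ^ 2) - 4 * R ^ 2 := by
    intro x y
    set m := h.geo x y (1 / 2)
    have h1 : r m ^ 2 ≤ r x ^ 2 / 2 + r y ^ 2 / 2 - dist x y ^ 2 / 4 := by
      have h2 : ∀ a ∈ A, dist m a ^ 2 ≤ r x ^ 2 / 2 + r y ^ 2 / 2 - dist x y ^ 2 / 4 := by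
        intro a ha
        have h3 := h.dist_midpoint_sq_le a x y
        rw [dist_comm a x, dist_comm a y, dist_comm a] at h3
        have h4 := pow_le_pow_left₀ dist_nonneg (hle x a ha) 2
        have h5 := pow_le_pow_left₀ dist_nonneg (hle y a ha) 2
        linarith
      have h0 := (sq_nonneg _).trans (h2 a₀ ha₀)
      have : r m ≤ √(r x ^ 2 / 2 + r y ^ 2 / 2 - dist x y ^ 2 / 4) :=
        ciSup_le fun a => Real.le_sqrt_of_sq_le (h2 a a.2)
      calc r m ^ 2 ≤ _ := pow_le_pow_left₀ (hr0 m) this 2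
        _ = _ := Real.sq_sqrt h0
    have h2 := pow_le_pow_left₀ hR0 (hRle m) 2
    linarith
  obtain ⟨u, -, hu2, hu3⟩ := exists_seq_tendsto_sInf (Set.range_nonempty r) hrbdd
  choose v hv using hu3
  have hvt : Filter.Tendsto (fun n => r (v n)) Filter.atTop (nhds R) := by
    simp only [hv]; exact hu2
  have hsq : Filter.Tendsto (fun n => r (v n) ^ 2 - R ^ 2) Filter.atTop (nhds 0) := by
    have := (hvt.pow 2).sub_const (R ^ 2)
    rwa [sub_self] at this
  have hcau : CauchySeq v := by
    rw [Metric.cauchySeq_iff']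
    intro ε hε
    have he : (0 : ℝ) < ε ^ 2 / 4 := by positivity
    obtain ⟨N, hN⟩ := Filter.eventually_atTop.mp (hsq.eventually (gt_mem_nhds he))
    refine ⟨N, fun n hn => ?_⟩
    have h1 := hN n hn
    have h2 := hN N le_rfl
    have h3 := key (v n) (v N)
    exact lt_of_pow_lt_pow_left₀ 2 hε.le (by linarith)
  obtain ⟨x, hx⟩ := cauchySeq_tendsto_of_complete hcau
  have hrx : r x = R := by
    refine le_antisymm (ciSup_le fun a => ?_) (hRle x)
    exact le_of_tendsto_of_tendsto (hx.dist tendsto_const_nhds) hvt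
      (Filter.Eventually.of_forall fun n => hle (v n) a a.2)
  refine ⟨x, fun f hf hfA => ?_⟩
  have hfx : r (f x) ≤ R := by
    refine ciSup_le fun a => ?_
    obtain ⟨b, hb, hba⟩ : (a : X) ∈ f '' A := hfA.symm ▸ a.2
    rw [← hba, hf.dist_eq, ← hrx]
    exact hle x b hb
  have h1 := key (f x) x
  rw [hrx, le_antisymm hfx (hRle _)] at h1
  have : dist (f x) x ^ 2 ≤ 0 := by linarith
  exact dist_eq_zero.mp (by nlinarith [dist_nonneg (x := f x) (y := x)])

end Geodesics

/-! ### Cubical Sperner lemma by cochains modulo 2. -/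

section Sperner

variable {V W : Type*}

/-- The coboundary modulo 2 of a cochain on ordered tuples. -/
def cobdry : (List V → ZMod 2) → List V → ZMod 2
  | _, [] => 0
  | f, a :: l => f l + cobdry (fun m => f (a :: m)) l

/-- The pullback of a cochain by the prism operator from `s` to `t`. -/
def prism (s t : V → W) : (List W → ZMod 2) → List V → ZMod 2
  | _, [] => 0
  | f, a :: l => f (s a :: t a :: l.map t) + prism s t (fun m => f (s a :: m)) l

theorem cobdry_add (f g : List V → ZMod 2) (l : List V) :
    cobdry (fun m => f m + g m) l = cobdry f l + cobdry g l := by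
  induction l generalizing f g with
  | nil => simp [cobdry]
  | cons a l ih => simp only [cobdry, ih]; ring

theorem cobdry_zero (l : List V) : cobdry (fun _ => 0) l = 0 := by
  induction l with
  | nil => rfl
  | cons a l ih => simp [cobdry, ih]

theorem cobdry_sum (M : ℕ) (f : ℕ → List V → ZMod 2) (l : List V) :
    cobdry (fun m => ∑ t ∈ Finset.range M, f t m) l = ∑ t ∈ Finset.range M, cobdry (f t) l := by
  induction M with
  | zero => simp [cobdry_zero]
  | succ M ih => simp only [Finset.sum_range_succ, cobdry_add, ih]

theorem cobdry_map (φ : V → W) (g : List W → ZMod 2) (l : List V) :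
    cobdry (fun m => g (m.map φ)) l = cobdry g (l.map φ) := by
  induction l generalizing g with
  | nil => rfl
  | cons a l ih =>
    simp only [cobdry, List.map_cons]
    rw [ih fun m => g (φ a :: m)]

theorem prism_add (s t : V → W) (f g : List W → ZMod 2) (l : List V) :
    prism s t (fun m => f m + g m) l = prism s t f l + prism s t g l := by
  induction l generalizing f g with
  | nil => simp [prism]
  | cons a l ih => simp only [prism, ih]; ring

theorem prism_congr (s t : V → W) (f g : List W → ZMod 2) (l : List V)
    (h : ∀ m : List W, m.length = l.length + 1 → (∀ w ∈ m, ∃ v ∈ l, w = s v ∨ w = t v) →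
      f m = g m) : prism s t f l = prism s t g l := by
  induction l generalizing f g with
  | nil => rfl
  | cons a l ih =>
    simp only [prism]
    congr 1
    · refine h _ (by simp) fun w hw => ?_
      simp only [List.mem_cons, List.mem_map] at hw ⊢
      rcases hw with rfl | rfl | ⟨v, hv, rfl⟩
      · exact ⟨a, by simp⟩
      · exact ⟨a, by simp⟩
      · exact ⟨v, by simp [hv]⟩
    · refine ih _ _ fun m hm hm' => h _ (by simp [hm]) fun w hw => ?_
      rcases List.mem_cons.mp hw with rfl | hw
      · exact ⟨a, by simp⟩
      · obtain ⟨v, hv, hwv⟩ := hm' w hw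
        exact ⟨v, by simp [hv], hwv⟩

theorem prism_zero (s t : V → W) (l : List V) : prism s t (fun _ => 0) l = 0 := by
  induction l with
  | nil => rfl
  | cons a l ih => simp [prism, ih]

/-- Chain homotopy formula: the boundary of a prism is its top, its bottom and the prism over the
boundary. Working modulo 2 removes all signs. -/
theorem prism_cobdry (s t : V → W) (f : List W → ZMod 2) (l : List V) :
    prism s t (cobdry f) l =
      cobdry (prism s t f) l + (f (l.map t) + f (l.map s)) := by
  induction l generalizing f with
  | nil => simp [prism, cobdry, CharTwo.add_self_eq_zero]
  | cons a l ih =>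
    have h1 := ih fun m => f (s a :: m)
    have h2 := cobdry_map t (fun m => f (s a :: t a :: m)) l
    simp only [prism, cobdry, prism_add, cobdry_add, List.map_cons, h1, ← h2]
    have h3 := CharTwo.add_self_eq_zero (f (s a :: l.map t))
    linear_combination h3

/-- The map between grids that appends a last coordinate. -/
def gridSnoc {N : ℕ} (t : ℕ) (p : Fin N → ℕ) : Fin (N + 1) → ℕ :=
  Fin.snoc (α := fun _ => ℕ) p t

@[simp] theorem gridSnoc_last {N : ℕ} (t : ℕ) (p : Fin N → ℕ) :
    gridSnoc t p (Fin.last N) = t := by simp [gridSnoc]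

@[simp] theorem gridSnoc_castSucc {N : ℕ} (t : ℕ) (p : Fin N → ℕ) (i : Fin N) :
    gridSnoc t p i.castSucc = p i := by simp [gridSnoc]

/-- Evaluation of a cochain on the fundamental chain of the grid `{0, …, M} ^ N`. -/
def cubeSum (M : ℕ) : ∀ N : ℕ, (List (Fin N → ℕ) → ZMod 2) → ZMod 2
  | 0, f => f [Fin.elim0]
  | N + 1, f => ∑ t ∈ Finset.range M, cubeSum M N (prism (gridSnoc t) (gridSnoc (t + 1)) f)

theorem cubeSum_congr (M N : ℕ) (f g : List (Fin N → ℕ) → ZMod 2)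
    (h : ∀ l : List (Fin N → ℕ), l.length = N + 1 →
      (∃ b : Fin N → ℕ, (∀ i, b i < M) ∧ ∀ v ∈ l, ∀ i, v i = b i ∨ v i = b i + 1) →
      f l = g l) : cubeSum M N f = cubeSum M N g := by
  induction N with
  | zero => exact h _ rfl ⟨Fin.elim0, fun i => i.elim0, fun _ _ i => i.elim0⟩
  | succ N ih =>
    refine Finset.sum_congr rfl fun t ht => ih _ _ fun l hl ⟨b, hb, hbl⟩ => ?_
    refine prism_congr _ _ _ _ _ fun m hm hml => h m (by omega) ⟨gridSnoc t b, ?_, ?_⟩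
    · intro i
      refine Fin.lastCases ?_ (fun i => ?_) i
      · simpa using ht
      · simpa using hb i
    · intro w hw i
      obtain ⟨v, hv, hwv⟩ := hml w hw
      refine Fin.lastCases ?_ (fun i => ?_) i
      · rcases hwv with rfl | rfl <;> simp
      · rcases hwv with rfl | rfl <;> simpa using hbl v hv i

theorem cubeSum_add (M N : ℕ) (f g : List (Fin N → ℕ) → ZMod 2) :
    cubeSum M N (fun l => f l + g l) = cubeSum M N f + cubeSum M N g := by
  induction N with
  | zero => rfl
  | succ N ih =>
    simp only [cubeSum, ← Finset.sum_add_distrib, ← ih]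
    refine Finset.sum_congr rfl fun t _ => ?_
    congr 1
    ext l
    exact prism_add _ _ _ _ _

theorem cubeSum_zero (M N : ℕ) : cubeSum M N (fun _ => 0) = 0 := by
  have := cubeSum_add M N (fun _ => 0) (fun _ => 0)
  simpa using this

theorem cubeSum_sum (M N K : ℕ) (f : ℕ → List (Fin N → ℕ) → ZMod 2) :
    cubeSum M N (fun m => ∑ t ∈ Finset.range K, f t m) =
      ∑ t ∈ Finset.range K, cubeSum M N (f t) := by
  induction K with
  | zero => simp [cubeSum_zero]
  | succ K ih => simp only [Finset.sum_range_succ, cubeSum_add, ih]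

theorem sum_range_add_succ_char_two (a : ℕ → ZMod 2) (M : ℕ) :
    ∑ t ∈ Finset.range M, (a (t + 1) + a t) = a M + a 0 := by
  induction M with
  | zero => simp [CharTwo.add_self_eq_zero]
  | succ M ih =>
    rw [Finset.sum_range_succ, ih]
    have := CharTwo.add_self_eq_zero (a M)
    linear_combination this

/-- Stokes' formula in the last coordinate: each interior wall is met from both sides and cancels
modulo 2, leaving the two end faces and the sides. -/
theorem cubeSum_succ_cobdry (M N : ℕ) (f : List (Fin (N + 1) → ℕ) → ZMod 2) :
    cubeSum M (N + 1) (cobdry f) =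
      cubeSum M N (cobdry fun l => ∑ t ∈ Finset.range M,
        prism (gridSnoc t) (gridSnoc (t + 1)) f l) +
      (cubeSum M N (fun l => f (l.map (gridSnoc M))) +
        cubeSum M N (fun l => f (l.map (gridSnoc 0)))) := by
  rw [← sum_range_add_succ_char_two fun t => cubeSum M N fun l => f (l.map (gridSnoc t))]
  have h1 : (cobdry fun l => ∑ t ∈ Finset.range M, prism (gridSnoc t) (gridSnoc (t + 1)) f l) =
      fun l : List (Fin N → ℕ) => ∑ t ∈ Finset.range M,
        cobdry (prism (gridSnoc t) (gridSnoc (t + 1)) f) l := by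
    ext l
    exact cobdry_sum M (fun t => prism (gridSnoc t) (gridSnoc (t + 1)) f) l
  rw [h1, cubeSum_sum, ← Finset.sum_add_distrib]
  refine Finset.sum_congr rfl fun t _ => ?_
  rw [← cubeSum_add, ← cubeSum_add]
  congr 1
  ext l
  exact prism_cobdry _ _ _ _

/-- Stokes' formula for a cochain vanishing on the boundary of the cube. In dimension 0 the boundary
of the point is the empty list, which explains `hf`. -/
theorem cubeSum_cobdry_eq_zero (M N : ℕ) (f : List (Fin N → ℕ) → ZMod 2)
    (h0 : ∀ (i : Fin N) l, (∀ v ∈ l, v i = 0) → f l = 0)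
    (hM : ∀ (i : Fin N) l, (∀ v ∈ l, v i = M) → f l = 0) (hf : N = 0 → f [] = 0) :
    cubeSum M N (cobdry f) = 0 := by
  induction N with
  | zero => simp [cubeSum, cobdry, hf]
  | succ N ih =>
    rw [cubeSum_succ_cobdry]
    have h1 : ∀ c, (∀ l, (∀ v ∈ l, v (Fin.last N) = c) → f l = 0) →
        cubeSum M N (fun l => f (l.map (gridSnoc c))) = 0 := by
      intro c hc
      rw [← cubeSum_zero M N]
      congr 1
      ext l
      refine hc _ fun v hv => ?_
      obtain ⟨p, -, rfl⟩ := List.mem_map.mp hv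
      simp
    rw [h1 M (hM _), h1 0 (h0 _), add_zero, add_zero]
    have h2 : ∀ c (i : Fin N), (∀ l, (∀ v ∈ l, v i.castSucc = c) → f l = 0) →
        ∀ l : List (Fin N → ℕ), (∀ v ∈ l, v i = c) →
          ∑ t ∈ Finset.range M, prism (gridSnoc t) (gridSnoc (t + 1)) f l = 0 := by
      intro c i hc l hl
      refine Finset.sum_eq_zero fun t _ => ?_
      rw [← prism_zero (gridSnoc t) (gridSnoc (t + 1)) l]
      refine prism_congr _ _ _ _ _ fun m _ hm => hc m fun w hw => ?_
      obtain ⟨v, hv, hwv⟩ := hm w hw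
      rcases hwv with rfl | rfl <;> simpa using hl v hv
    exact ih _ (fun i => h2 0 i (h0 _)) (fun i => h2 M i (hM _)) (fun _ => by simp [prism])

theorem cobdry_coe (G : Multiset ℕ → ZMod 2) (l : List ℕ) :
    cobdry (fun m => G m) l = (l.map fun x => G ((l : Multiset ℕ).erase x)).sum := by
  induction l generalizing G with
  | nil => rfl
  | cons a l ih =>
    have := ih fun m => G (a ::ₘ m)
    simp only [cobdry, List.map_cons, List.sum_cons, ← Multiset.cons_coe, Multiset.erase_cons_head]
    rw [this]
    congr 2
    refine List.map_congr_left fun x hx => ?_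
    by_cases hxa : x = a
    · rw [hxa, Multiset.erase_cons_head, Multiset.cons_erase (by simpa [hxa] using hx)]
    · rw [Multiset.erase_cons_tail _ (Ne.symm hxa)]

theorem sum_map_ite_eq_count (l : List ℕ) (x₀ : ℕ) :
    (l.map fun x => if x = x₀ then (1 : ZMod 2) else 0).sum = (l.count x₀ : ZMod 2) := by
  induction l with
  | nil => simp
  | cons a l ih =>
    rw [List.map_cons, List.sum_cons, ih, List.count_cons]
    by_cases h : a = x₀ <;> simp [h, add_comm]

/-- The parity count in Sperner's lemma. If deleting x₀ leaves the labels 0, …, K - 1, then either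
x₀ = K and only one deletion works, or x₀ < K is repeated and the two possible deletions cancel. -/
theorem cobdry_range (K : ℕ) (l : List ℕ) (hl : ∀ x ∈ l, x ≤ K) :
    cobdry (fun m => if (m : Multiset ℕ) = Multiset.range K then (1 : ZMod 2) else 0) l =
      if (l : Multiset ℕ) = Multiset.range (K + 1) then 1 else 0 := by
  rw [cobdry_coe fun s => if s = Multiset.range K then (1 : ZMod 2) else 0]
  by_cases hx : ∃ x₀ ∈ l, (l : Multiset ℕ).erase x₀ = Multiset.range K
  · obtain ⟨x₀, hx₀, h⟩ := hx
    have hlx : (l : Multiset ℕ) = x₀ ::ₘ Multiset.range K := by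
      rw [← h, Multiset.cons_erase (by simpa using hx₀)]
    have h1 : (l.map fun x => if (l : Multiset ℕ).erase x = Multiset.range K
        then (1 : ZMod 2) else 0) = l.map fun x => if x = x₀ then (1 : ZMod 2) else 0 := by
      refine List.map_congr_left fun x hxl => ?_
      congr 1
      refine propext ⟨fun hx => ?_, fun hx => hx ▸ h⟩
      have : (l : Multiset ℕ) = x ::ₘ Multiset.range K := by
        rw [← hx, Multiset.cons_erase (by simpa using hxl)]
      rw [hlx] at this
      exact ((Multiset.cons_inj_left _).mp this).symm
    rw [h1, sum_map_ite_eq_count, ← Multiset.coe_count, hlx, Multiset.count_cons_self,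
      Multiset.range_succ]
    rcases (hl x₀ hx₀).eq_or_lt with rfl | hlt
    · simp [Multiset.count_eq_zero_of_notMem]
    · rw [Multiset.count_eq_one_of_mem (Multiset.nodup_range K) (Multiset.mem_range.mpr hlt),
        if_neg]
      · decide
      · intro h
        exact hlt.ne ((Multiset.cons_inj_left _).mp h)
  · push Not at hx
    rw [if_neg]
    · refine List.sum_eq_zero fun y hy => ?_
      obtain ⟨x, hxl, rfl⟩ := List.mem_map.mp hy
      exact if_neg (hx x hxl)
    · intro h
      refine hx K ?_ ?_
      · rw [← Multiset.mem_coe, h]; simp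
      · rw [h, Multiset.range_succ, Multiset.erase_cons_head]

/-- The indicator of full label sets is the coboundary of the indicator of label sets without the
top label, so by Stokes only the boundary matters. Every face misses a lower label, except the one
where the last coordinate is 0; that face carries a labelling of the same kind in one dimension
less. -/
theorem cubeSum_full_labels (M N : ℕ) (lab : (Fin N → ℕ) → ℕ) (hN : ∀ p, lab p ≤ N)
    (h0 : ∀ p (i : Fin N), p i = 0 → lab p ≤ i) (hM : ∀ p (i : Fin N), p i = M → lab p ≠ i) :
    cubeSum M N (fun l => if (l.map lab : Multiset ℕ) = Multiset.range (N + 1)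
      then (1 : ZMod 2) else 0) = 1 := by
  induction N with
  | zero =>
    have : lab Fin.elim0 = 0 := Nat.le_zero.mp (hN _)
    simp [cubeSum, this]
  | succ N ih =>
    set f : List (Fin (N + 1) → ℕ) → ZMod 2 := fun l =>
      if (l.map lab : Multiset ℕ) = Multiset.range (N + 1) then 1 else 0 with hf
    have hfz : ∀ (j : ℕ) (l : List (Fin (N + 1) → ℕ)), j ≤ N → (∀ v ∈ l, lab v ≠ j) →
        f l = 0 := by
      intro j l hj hl
      refine if_neg fun h => ?_
      have : j ∈ (l.map lab : Multiset ℕ) := by rw [h]; simp; omega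
      simp only [Multiset.mem_coe, List.mem_map] at this
      obtain ⟨v, hv, hvj⟩ := this
      exact hl v hv hvj
    have h1 : cubeSum M (N + 1) (fun l => if (l.map lab : Multiset ℕ) =
        Multiset.range (N + 1 + 1) then (1 : ZMod 2) else 0) = cubeSum M (N + 1) (cobdry f) := by
      refine cubeSum_congr _ _ _ _ fun l _ _ => ?_
      rw [hf, cobdry_map lab
        (fun m => if (m : Multiset ℕ) = Multiset.range (N + 1) then (1 : ZMod 2) else 0),
        cobdry_range]
      intro x hx
      obtain ⟨p, -, rfl⟩ := List.mem_map.mp hx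
      exact hN p
    have hp : ∀ (i : Fin N) (j : ℕ), j ≤ N → ∀ c, (∀ v : Fin (N + 1) → ℕ, v i.castSucc = c →
        lab v ≠ j) → ∀ l : List (Fin N → ℕ), (∀ v ∈ l, v i = c) →
          ∑ t ∈ Finset.range M, prism (gridSnoc t) (gridSnoc (t + 1)) f l = 0 := by
      intro i j hj c hc l hl
      refine Finset.sum_eq_zero fun t _ => ?_
      rw [← prism_zero (gridSnoc t) (gridSnoc (t + 1)) l]
      refine prism_congr _ _ _ _ _ fun m _ hm => hfz j m hj fun w hw => hc w ?_
      obtain ⟨v, hv, hwv⟩ := hm w hw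
      rcases hwv with rfl | rfl <;> simpa using hl v hv
    rw [h1, cubeSum_succ_cobdry, cubeSum_cobdry_eq_zero M N, zero_add]
    · have h2 : cubeSum M N (fun l => f (l.map (gridSnoc M))) = 0 := by
        rw [← cubeSum_zero M N]
        congr 1
        ext l
        refine hfz N _ le_rfl fun v hv => ?_
        obtain ⟨p, -, rfl⟩ := List.mem_map.mp hv
        have := hM (gridSnoc M p) (Fin.last N) (by simp)
        simpa using this
      rw [h2, zero_add]
      have h3 := ih (fun p => lab (gridSnoc 0 p))
        (fun p => by simpa using h0 (gridSnoc 0 p) (Fin.last N) (by simp))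
        (fun p i hi => by simpa using h0 (gridSnoc 0 p) i.castSucc (by simpa using hi))
        (fun p i hi => by simpa using hM (gridSnoc 0 p) i.castSucc (by simpa using hi))
      rw [← h3]
      congr 1
      ext l
      simp only [hf, List.map_map]
      rfl
    · intro i
      refine hp i N le_rfl 0 fun v hv => ?_
      have := h0 v i.castSucc hv
      have := i.2
      simp at *
      omega
    · intro i
      refine hp i i i.2.le M fun v hv => ?_
      simpa using hM v i.castSucc hv
    · intro _
      exact Finset.sum_eq_zero fun t _ => rfl

/-- The cubical Sperner lemma of Kuhn. -/
theorem exists_small_cube_full_labels (M N : ℕ) (lab : (Fin N → ℕ) → ℕ) (hN : ∀ p, lab p ≤ N)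
    (h0 : ∀ p (i : Fin N), p i = 0 → lab p ≤ i) (hM : ∀ p (i : Fin N), p i = M → lab p ≠ i) :
    ∃ b : Fin N → ℕ, (∀ i, b i < M) ∧ ∀ j ≤ N, ∃ v : Fin N → ℕ,
      (∀ i, v i = b i ∨ v i = b i + 1) ∧ lab v = j := by
  by_contra hcon
  have h1 := cubeSum_full_labels M N lab hN h0 hM
  rw [cubeSum_congr M N _ (fun _ => 0), cubeSum_zero] at h1
  · exact zero_ne_one h1
  · intro l _ ⟨b, hb, hbl⟩
    refine if_neg fun h => hcon ⟨b, hb, fun j hj => ?_⟩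
    have : j ∈ (l.map lab : Multiset ℕ) := by rw [h]; simp; omega
    simp only [Multiset.mem_coe, List.mem_map] at this
    obtain ⟨v, hv, hvj⟩ := this
    exact ⟨v, hbl v hv, hvj⟩

end Sperner

/-! ### Filling cubes geodesically, Lebesgue's covering theorem, and the Helly-type theorem. -/

section CubeFilling

variable {X : Type*} [MetricSpace X]

/-- The map from the cube to a CAT(0) space with prescribed values on the vertices, obtained by
iterated geodesic interpolation. -/
noncomputable def IsCAT0.cubeFill (h : IsCAT0 X) :
    ∀ N : ℕ, ((Fin N → Bool) → X) → (Fin N → unitInterval) → X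
  | 0, x, _ => x Fin.elim0
  | N + 1, x, p => h.geo (h.cubeFill N (fun l => x (Fin.cons (α := fun _ => Bool) false l))
      (fun i => p i.succ)) (h.cubeFill N (fun l => x (Fin.cons (α := fun _ => Bool) true l))
      (fun i => p i.succ)) (p 0)

theorem IsCAT0.continuous_cubeFill (h : IsCAT0 X) (N : ℕ) (x : (Fin N → Bool) → X) :
    Continuous (h.cubeFill N x) := by
  induction N with
  | zero => exact continuous_const
  | succ N ih =>
    exact h.continuous_geo ((ih _).comp (by fun_prop)) ((ih _).comp (by fun_prop))
      (continuous_apply 0)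

/-- The vertices constrained by `hx` are those of the smallest face containing `p`: a coordinate 0
or 1 puts the interpolation at an endpoint, so other vertices play no role. -/
theorem IsCAT0.cubeFill_mem (h : IsCAT0 X) {C : Set X}
    (hC : ∀ x ∈ C, ∀ y ∈ C, ∀ s : unitInterval, h.geo x y s ∈ C) (N : ℕ)
    (x : (Fin N → Bool) → X) (p : Fin N → unitInterval)
    (hx : ∀ l : Fin N → Bool, (∀ i, p i = 0 → l i = false) → (∀ i, p i = 1 → l i = true) →
      x l ∈ C) : h.cubeFill N x p ∈ C := by
  induction N with
  | zero => exact hx _ (fun i => i.elim0) (fun i => i.elim0)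
  | succ N ih =>
    have key : ∀ β : Bool, (p 0 = 0 → β = false) → (p 0 = 1 → β = true) →
        h.cubeFill N (fun l => x (Fin.cons (α := fun _ => Bool) β l)) (fun i => p i.succ) ∈ C := by
      intro β h0 h1
      refine ih _ _ fun l hl0 hl1 => hx _ (fun i => ?_) (fun i => ?_)
      · refine Fin.cases ?_ (fun i => ?_) i
        · simpa using h0
        · simpa using hl0 i
      · refine Fin.cases ?_ (fun i => ?_) i
        · simpa using h1
        · simpa using hl1 i
    rw [cubeFill]
    by_cases h0 : p 0 = 0
    · rw [h0, Set.Icc.coe_zero, geo_zero]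
      exact key false (fun _ => rfl) (fun h1 => by simp [h0] at h1)
    by_cases h1 : p 0 = 1
    · rw [h1, Set.Icc.coe_one, geo_one]
      exact key true (fun h0 => by simp [h1] at h0) (fun _ => rfl)
    · exact hC _ (key false (fun _ => rfl) (fun h => absurd h h1)) _
        (key true (fun h => absurd h h0) (fun _ => rfl)) _

end CubeFilling

/-- The covering theorem of Lebesgue, for maps from a cube to a space of small dimension. -/
theorem HasCoveringDimLE.false_of_cube {X : Type*} [TopologicalSpace X] {d N : ℕ}
    (hd : HasCoveringDimLE X d) (hdN : d < N) (F : (Fin N → unitInterval) → X)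
    (hF : Continuous F) (U : Fin (N + 1) → Set X) (hU : ∀ j, IsOpen (U j))
    (hcov : ∀ x, ∃ j, x ∈ U j)
    (h0 : ∀ p (i : Fin N) (j : Fin (N + 1)), p i = 0 → F p ∈ U j → (j : ℕ) ≤ i)
    (h1 : ∀ p (i : Fin N) (j : Fin (N + 1)), p i = 1 → F p ∈ U j → (j : ℕ) ≠ i) : False := by
  obtain ⟨V, -, hVo, hVc, hVU, hVd⟩ := hd (Set.range U) (Set.finite_range U)
    (by rintro _ ⟨j, rfl⟩; exact hU j)
    (Set.eq_univ_of_forall fun x => by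
      obtain ⟨j, hj⟩ := hcov x
      exact ⟨U j, ⟨j, rfl⟩, hj⟩)
  have hVU' : ∀ v : V, ∃ j, (v : Set X) ⊆ U j := by
    intro v
    obtain ⟨_, ⟨j, rfl⟩, hj⟩ := hVU v v.2
    exact ⟨j, hj⟩
  choose assign hassign using hVU'
  obtain ⟨δ, hδ, hball⟩ := lebesgue_number_lemma_of_metric_sUnion
    (c := (fun v => F ⁻¹' v) '' V) (isCompact_univ (X := Fin N → unitInterval))
    (by rintro _ ⟨v, hv, rfl⟩; exact (hVo v hv).preimage hF)
    (fun p _ => by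
      obtain ⟨v, hv, hpv⟩ : F p ∈ ⋃₀ V := hVc ▸ Set.mem_univ _
      exact ⟨F ⁻¹' v, ⟨v, hv, rfl⟩, hpv⟩)
  have hball' : ∀ p : Fin N → unitInterval, ∃ v : V, Metric.ball p δ ⊆ F ⁻¹' v := by
    intro p
    obtain ⟨_, ⟨v, hv, rfl⟩, hpv⟩ := hball p (Set.mem_univ _)
    exact ⟨⟨v, hv⟩, hpv⟩
  choose nbhd hnbhd using hball'
  obtain ⟨m, hm⟩ := exists_nat_one_div_lt hδ
  set M := m + 1 with hM
  have hM0 : (0 : ℝ) < M := by positivity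
  -- Truncation by `min` makes the grid point meaningful for all tuples of naturals, as the Sperner
  -- lemma labels all of them.
  set pt : (Fin N → ℕ) → (Fin N → unitInterval) := fun g i =>
    ⟨(min (g i) M : ℕ) / M, by positivity, by
      rw [div_le_one hM0]; exact_mod_cast min_le_right _ _⟩ with hpt
  have hmem : ∀ g, F (pt g) ∈ (nbhd (pt g) : Set X) := fun g =>
    hnbhd _ (Metric.mem_ball_self hδ)
  have hmemU : ∀ g, F (pt g) ∈ U (assign (nbhd (pt g))) := fun g => hassign _ (hmem g)
  obtain ⟨b, -, hb⟩ := exists_small_cube_full_labels M N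
    (fun g => (assign (nbhd (pt g)) : ℕ)) (fun g => Nat.lt_succ_iff.mp (Fin.is_lt _))
    (fun g i hi => h0 (pt g) i _ (by ext; simp [hpt, hi]) (hmemU g))
    (fun g i hi => h1 (pt g) i _ (by ext; simp [hpt, hi, hM0.ne']) (hmemU g))
  have hb' : ∀ j : Fin (N + 1), ∃ v : Fin N → ℕ, (∀ i, v i = b i ∨ v i = b i + 1) ∧
      assign (nbhd (pt v)) = j := by
    intro j
    obtain ⟨v, hv, hvj⟩ := hb j (Nat.lt_succ_iff.mp j.2)
    exact ⟨v, hv, Fin.ext hvj⟩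
  choose g hg hgj using hb'
  -- Each chosen member contains the image of a δ-ball about its grid point, so the image of one
  -- vertex of the small cube lies in all N + 1 chosen members.
  have hclose : ∀ j, pt (g 0) ∈ Metric.ball (pt (g j)) δ := by
    intro j
    rw [Metric.mem_ball, dist_pi_lt_iff hδ]
    intro i
    refine lt_of_le_of_lt ?_ hm
    rw [Subtype.dist_eq, Real.dist_eq, ← sub_div, abs_div, abs_of_pos hM0]
    push_cast [hM]
    gcongr
    rw [abs_le]
    have h1 : (min (g 0 i) M : ℕ) ≤ (min (g j i) M : ℕ) + 1 := by
      rcases hg 0 i with h | h <;> rcases hg j i with h' | h' <;> omega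
    have h2 : (min (g j i) M : ℕ) ≤ (min (g 0 i) M : ℕ) + 1 := by
      rcases hg 0 i with h | h <;> rcases hg j i with h' | h' <;> omega
    have h1' : ((min (g 0 i) M : ℕ) : ℝ) ≤ (min (g j i) M : ℕ) + 1 := by exact_mod_cast h1
    have h2' : ((min (g j i) M : ℕ) : ℝ) ≤ (min (g 0 i) M : ℕ) + 1 := by exact_mod_cast h2
    push_cast [hM] at h1' h2'
    constructor <;> linarith
  set w : Fin (N + 1) → Set X := fun j => (nbhd (pt (g j)) : Set X) with hw
  -- Distinct labels come from distinct members of the refinement, so N + 1 different members meet.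
  have hinj : Function.Injective w := by
    intro j j' hjj
    rw [← hgj j, ← hgj j', Subtype.ext hjj]
  have hsub : Set.range w ⊆ {v ∈ V | F (pt (g 0)) ∈ v} := by
    rintro _ ⟨j, rfl⟩
    exact ⟨(nbhd _).2, hnbhd _ (hclose j)⟩
  have hcard : (Set.range w).encard = (N + 1 : ℕ) := by
    rw [← Set.image_univ, hinj.injOn.encard_image, Set.encard_univ]
    simp
  have := (Set.encard_le_encard hsub).trans (hVd (F (pt (g 0))))
  rw [hcard] at this
  have : N + 1 ≤ d + 1 := by exact_mod_cast this
  omega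

/-- Turns a vertex of the k-cube into one of k + 1 indices: the first `false` entry, or the last
index if there is none. The two properties are the ones that become Sperner's boundary conditions.
-/
theorem exists_first_false {k : ℕ} (f : Fin k → Bool) : ∃ a : Fin (k + 1),
    (∀ j, f j = true → a ≠ j.castSucc) ∧ ∀ j, f j = false → a ≤ j.castSucc := by
  classical
  by_cases h : ∃ j : ℕ, ∃ hj : j < k, f ⟨j, hj⟩ = false
  · obtain ⟨hk, hf⟩ := Nat.find_spec h
    refine ⟨⟨Nat.find h, by omega⟩, fun j hj e => ?_, fun j hj => ?_⟩
    · have : (⟨Nat.find h, hk⟩ : Fin k) = j := by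
        ext; simpa [Fin.ext_iff] using e
      rw [this, hj] at hf
      cases hf
    · exact Nat.find_min' h ⟨j.2, hj⟩
  · push Not at h
    refine ⟨Fin.last k, fun j _ e => ?_, fun j hj => absurd hj (h j j.2)⟩
    have := congrArg Fin.val e
    have := j.2
    simp at *
    omega

/-- A Helly-type theorem: in a CAT(0) space of dimension `d < c * k`, there are no `c` families of
`k + 1` closed convex subsets, each with empty intersection, such that any choice of all but one
member of each family has non-empty intersection. -/
theorem IsCAT0.exists_inter_nonempty {X : Type*} [MetricSpace X] (h : IsCAT0 X) {d c k : ℕ}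
    (hd : HasCoveringDimLE X d) (hdc : d < c * k) (C : Fin c → Fin (k + 1) → Set X)
    (hcl : ∀ i a, IsClosed (C i a))
    (hconv : ∀ i a, ∀ x ∈ C i a, ∀ y ∈ C i a, ∀ s : unitInterval, h.geo x y s ∈ C i a)
    (hmix : ∀ α : Fin c → Fin (k + 1), ∃ x, ∀ i b, b ≠ α i → x ∈ C i b) :
    ∃ i x, ∀ a, x ∈ C i a := by
  by_contra! hempty
  let e : Fin c × Fin k ≃ Fin (c * k) := finProdFinEquiv
  have he : ∀ i j, ((e (i, j) : Fin (c * k)) : ℕ) = j + k * i := fun i j => rfl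
  choose first hfirst1 hfirst0 using fun f : Fin k → Bool => exists_first_false f
  choose x hx using hmix
  set y : (Fin (c * k) → Bool) → X := fun l => x fun i => first fun j => l (e (i, j)) with hy
  set F := h.cubeFill (c * k) y with hF
  have hF0 : ∀ p i j, p (e (i, j)) = 0 → ∀ b, j.castSucc < b → F p ∈ C i b := by
    intro p i j hp b hb
    refine h.cubeFill_mem (hconv i b) _ _ _ fun l hl0 _ => hx _ _ _ ?_
    exact (lt_of_le_of_lt (hfirst0 _ j (hl0 _ hp)) hb).ne'
  have hF1 : ∀ p i j, p (e (i, j)) = 1 → F p ∈ C i j.castSucc := by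
    intro p i j hp
    refine h.cubeFill_mem (hconv i _) _ _ _ fun l _ hl1 => hx _ _ _ ?_
    exact (hfirst1 _ j (hl1 _ hp)).symm
  -- The label of (i, j) means: outside member j of family i, and outside the last members of all
  -- earlier families. The final label c * k means: outside all the last members.
  set U : Fin (c * k + 1) → Set X := fun m =>
    (⋂ i : Fin c, ⋂ _ : k * (i + 1) ≤ m, (C i (Fin.last k))ᶜ) ∩
      ⋂ i : Fin c, ⋂ j : Fin k, ⋂ _ : (e (i, j) : ℕ) = m, (C i j.castSucc)ᶜ with hU
  have hUmem : ∀ m z, z ∈ U m ↔ (∀ i : Fin c, k * (i + 1) ≤ m → z ∉ C i (Fin.last k)) ∧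
      ∀ i j, (e (i, j) : ℕ) = m → z ∉ C i j.castSucc := by
    intro m z
    simp only [hU, Set.mem_inter_iff, Set.mem_iInter, Set.mem_compl_iff]
  refine hd.false_of_cube hdc F (h.continuous_cubeFill _ _) U ?_ ?_ ?_ ?_
  · intro m
    refine IsOpen.inter ?_ ?_
    · exact isOpen_iInter_of_finite fun i => isOpen_iInter_of_finite fun _ =>
        (hcl _ _).isOpen_compl
    · exact isOpen_iInter_of_finite fun i => isOpen_iInter_of_finite fun j =>
        isOpen_iInter_of_finite fun _ => (hcl _ _).isOpen_compl
  · intro z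
    by_cases hz : ∃ i : ℕ, ∃ hi : i < c, z ∈ C ⟨i, hi⟩ (Fin.last k)
    · classical
      -- Take the first family whose last member contains `z`. Its total intersection is empty, so
      -- `z` misses another member, which supplies the label.
      obtain ⟨hi, hzi⟩ := Nat.find_spec hz
      obtain ⟨a, ha⟩ := hempty ⟨Nat.find hz, hi⟩ z
      obtain ⟨j, rfl⟩ : ∃ j : Fin k, j.castSucc = a := by
        refine Fin.exists_castSucc_eq.mpr fun hl => ha (hl ▸ hzi)
      refine ⟨(e (⟨Nat.find hz, hi⟩, j)).castSucc, (hUmem _ _).mpr ⟨fun i hle hzi' => ?_, ?_⟩⟩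
      · rw [Fin.val_castSucc, he] at hle
        have h1 := Nat.find_min' hz ⟨i.2, hzi'⟩
        have h2 := Nat.mul_le_mul_left k h1
        have := j.2
        simp only at hle
        nlinarith
      · intro i j' hij
        have := e.injective (Fin.ext (by simpa using hij) : e (i, j') = e (⟨Nat.find hz, hi⟩, j))
        simp only [Prod.mk.injEq] at this
        rw [this.1, this.2]
        exact ha
    · push Not at hz
      refine ⟨Fin.last _, (hUmem _ _).mpr ⟨fun i _ => hz i i.2, fun i j hij => ?_⟩⟩
      have := (e (i, j)).2
      simp at hij
      omega
  · intro p m j hp hmem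
    obtain ⟨⟨i, a⟩, rfl⟩ := e.surjective m
    obtain ⟨hu1, hu2⟩ := (hUmem _ _).mp hmem
    by_contra! hlt
    rw [he] at hlt
    by_cases hk : k * (i + 1) ≤ j
    · exact hu1 i hk (hF0 p i a hp _ (Fin.castSucc_lt_last a))
    · have hjk : (j : ℕ) - k * i < k := by
        rw [mul_add] at hk; omega
      refine hu2 i ⟨j - k * i, hjk⟩ ?_ (hF0 p i a hp _ ?_)
      · rw [he]; simp only; omega
      · rw [Fin.lt_def]; simp only [Fin.val_castSucc]; omega
  · intro p m j hp hmem hjm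
    obtain ⟨⟨i, a⟩, rfl⟩ := e.surjective m
    exact ((hUmem _ _).mp hmem).2 i a hjm.symm (hF1 p i a hp)

/-! ### Sets of isometries with a common fixed point. -/

section Elliptic

variable {G : Type*} [Group G] (X : Type*) [MulAction G X]

/-- A set of group elements is elliptic if it has a common fixed point. -/
def Elliptic (S : Set G) : Prop := ∃ x : X, ∀ g ∈ S, g • x = x

variable {X}

theorem Elliptic.mono {S T : Set G} (h : Elliptic X T) (hST : S ⊆ T) : Elliptic X S :=
  h.imp fun _ hx g hg => hx g (hST hg)

theorem Elliptic.closure {S : Set G} (h : Elliptic X S) :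
    Elliptic X (Subgroup.closure S : Set G) := by
  obtain ⟨x, hx⟩ := h
  refine ⟨x, fun g hg => ?_⟩
  have : Subgroup.closure S ≤ MulAction.stabilizer G x :=
    (Subgroup.closure_le _).mpr fun g hg => hx g hg
  exact this hg

theorem Elliptic.of_subset_closure {S T : Set G} (h : Elliptic X T)
    (hST : S ⊆ (Subgroup.closure T : Set G)) : Elliptic X S :=
  h.closure.mono hST

theorem Elliptic.conj {S T : Set G} (h : Elliptic X S) (g : G)
    (hT : ∀ t ∈ T, g⁻¹ * t * g ∈ Subgroup.closure S) : Elliptic X T := by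
  obtain ⟨x, hx⟩ := h.closure
  refine ⟨g • x, fun t ht => ?_⟩
  have := hx _ (hT t ht)
  rw [mul_smul, mul_smul, inv_smul_eq_iff] at this
  exact this

variable [MetricSpace X]

theorem isClosed_fixed [IsIsometricSMul G X] (S : Set G) :
    IsClosed {x : X | ∀ g ∈ S, g • x = x} := by
  simp only [Set.ofPred_forall]
  exact isClosed_iInter fun g => isClosed_iInter fun _ =>
    isClosed_eq (isometry_smul X g).continuous continuous_id

/-- Uniqueness of geodesics makes fixed-point sets convex, as the Helly-type theorem requires. -/
theorem IsCAT0.smul_geo [IsIsometricSMul G X] (h : IsCAT0 X) {g : G} {x y : X} (hx : g • x = x)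
    (hy : g • y = y) (s : unitInterval) : g • h.geo x y s = h.geo x y s := by
  have hg : IsGeodesic (fun t => g • h.geo x y t) x y :=
    { map_zero := by rw [geo_zero, hx]
      map_one := by rw [geo_one, hy]
      dist_eq := fun s hs t ht => by
        rw [dist_smul, (h.isGeodesic_geo x y).dist_eq s hs t ht] }
  exact h.geodesic_unique hg (h.isGeodesic_geo x y) s.2

variable [IsIsometricSMul G X] [CompleteSpace X]

theorem IsCAT0.elliptic_of_bounded (h : IsCAT0 X) {S : Set G} {A : Set X} (hA : A.Nonempty)
    (hb : Bornology.IsBounded A) (hS : ∀ g ∈ S, (fun x => g • x) '' A = A) : Elliptic X S := by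
  obtain ⟨x, hx⟩ := h.exists_circumcenter hA hb
  exact ⟨x, fun g hg => hx _ (isometry_smul X g) (hS g hg)⟩

/-- Take a point fixed by `A` and its orbit under the group generated by `B`. The orbit is bounded
because `B` has a fixed point, and `A` fixes it pointwise because `B` normalizes the group generated
by `A`. The circumcenter of the orbit is fixed by both. -/
theorem IsCAT0.elliptic_union (h : IsCAT0 X) {A B : Set G} (hA : Elliptic X A)
    (hB : Elliptic X B) (hAB : ∀ b ∈ B, ∀ a ∈ A, b * a * b⁻¹ ∈ Subgroup.closure A ∧
      b⁻¹ * a * b ∈ Subgroup.closure A) : Elliptic X (A ∪ B) := by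
  obtain ⟨x, hx⟩ := hA.closure
  obtain ⟨y, hy⟩ := hB.closure
  have hN : ∀ k ∈ Subgroup.closure B, ∀ a ∈ Subgroup.closure A,
      k⁻¹ * a * k ∈ Subgroup.closure A := by
    have h1 : ∀ b : G, (∀ a ∈ A, b * a * b⁻¹ ∈ Subgroup.closure A) →
        ∀ a ∈ Subgroup.closure A, b * a * b⁻¹ ∈ Subgroup.closure A := by
      intro b hb a ha
      have : Subgroup.closure A ≤ (Subgroup.closure A).comap (MulAut.conj b).toMonoidHom :=
        (Subgroup.closure_le _).mpr fun a ha => by simpa using hb a ha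
      simpa using this ha
    have h2 : ∀ b ∈ B, ∀ a ∈ Subgroup.closure A, b⁻¹ * a * b ∈ Subgroup.closure A := by
      intro b hb a ha
      simpa using h1 b⁻¹ (fun a ha => by simpa using (hAB b hb a ha).2) a ha
    intro k hk
    induction hk using Subgroup.closure_induction'' with
    | one => simp
    | mem b hb => exact h2 b hb
    | inv_mem b hb =>
      intro a ha
      simpa using h1 b (fun a ha => (hAB b hb a ha).1) a ha
    | mul k l _ _ ihk ihl =>
      intro a ha
      have := ihl _ (ihk a ha)
      simpa [mul_assoc] using this
  refine h.elliptic_of_bounded (A := (fun k : G => k • x) '' (Subgroup.closure B : Set G))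
    ⟨x, 1, one_mem _, one_smul _ _⟩ ?_ ?_
  · refine (Metric.isBounded_closedBall (x := y) (r := dist x y)).subset ?_
    rintro _ ⟨k, hk, rfl⟩
    rw [Metric.mem_closedBall]
    conv_lhs => rw [← hy k hk]
    exact (dist_smul _ _ _).le
  · rintro g (hg | hg)
    · have : ∀ z ∈ (fun k : G => k • x) '' (Subgroup.closure B : Set G), g • z = z := by
        rintro _ ⟨k, hk, rfl⟩
        have := hx _ (hN k hk g (Subgroup.subset_closure hg))
        rwa [mul_smul, mul_smul, inv_smul_eq_iff] at this
      rw [Set.image_congr this, Set.image_id']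
    · have hg' := Subgroup.subset_closure hg
      ext z
      constructor
      · rintro ⟨_, ⟨k, hk, rfl⟩, rfl⟩
        exact ⟨g * k, mul_mem hg' hk, mul_smul _ _ _⟩
      · rintro ⟨k, hk, rfl⟩
        exact ⟨(g⁻¹ * k) • x, ⟨g⁻¹ * k, mul_mem (inv_mem hg') hk, rfl⟩, by simp [mul_smul]⟩

theorem IsCAT0.elliptic_union_of_commute (h : IsCAT0 X) {A B : Set G} (hA : Elliptic X A)
    (hB : Elliptic X B) (hAB : ∀ a ∈ A, ∀ b ∈ B, Commute a b) : Elliptic X (A ∪ B) := by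
  refine h.elliptic_union hA hB fun b hb a ha => ?_
  have hc := hAB a ha b hb
  rw [← hc.eq, mul_inv_cancel_right, mul_assoc, hc.eq, inv_mul_cancel_left]
  exact ⟨Subgroup.subset_closure ha, Subgroup.subset_closure ha⟩

theorem IsCAT0.elliptic_iUnion_of_commute [Nonempty X] (h : IsCAT0 X) {ι : Type*} [Finite ι]
    {S : ι → Set G} (hS : ∀ i, Elliptic X (S i))
    (hc : ∀ i j, i ≠ j → ∀ a ∈ S i, ∀ b ∈ S j, Commute a b) : Elliptic X (⋃ i, S i) := by
  classical
  have := Fintype.ofFinite ι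
  have key : ∀ s : Finset ι, Elliptic X (⋃ i ∈ s, S i) := by
    intro s
    induction s using Finset.induction_on with
    | empty => exact ⟨Classical.arbitrary X, by simp⟩
    | insert i s his ih =>
      rw [Finset.set_biUnion_insert]
      refine h.elliptic_union_of_commute (hS i) ih fun a ha b hb => ?_
      obtain ⟨j, hj, hbj⟩ := Set.mem_iUnion₂.mp hb
      exact hc i j (fun e => his (e ▸ hj)) a ha b hbj
  simpa using key Finset.univ

theorem IsCAT0.elliptic_singleton_of_sq (h : IsCAT0 X) {g : G} (hg : Elliptic X {g ^ 2}) :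
    Elliptic X {g} := by
  obtain ⟨x, hx⟩ := hg
  refine h.elliptic_of_bounded (A := {x, g • x}) (by simp) (Set.toFinite _).isBounded ?_
  rintro _ rfl
  rw [Set.image_pair, smul_smul, ← sq, hx _ rfl, Set.pair_comm]

theorem IsCAT0.elliptic_of_finite [Nonempty X] (h : IsCAT0 X) (H : Subgroup G) [Finite H] :
    Elliptic X (H : Set G) := by
  obtain ⟨x⟩ := ‹Nonempty X›
  refine h.elliptic_of_bounded (A := (fun k : G => k • x) '' (H : Set G))
    ⟨x, 1, one_mem _, one_smul _ _⟩ ((Set.toFinite _).image _).isBounded fun g hg => ?_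
  ext z
  constructor
  · rintro ⟨_, ⟨k, hk, rfl⟩, rfl⟩
    exact ⟨g * k, mul_mem hg hk, mul_smul _ _ _⟩
  · rintro ⟨k, hk, rfl⟩
    exact ⟨(g⁻¹ * k) • x, ⟨g⁻¹ * k, mul_mem (inv_mem hg) hk, rfl⟩, by simp [mul_smul]⟩

/-- Bootstrapping of fixed points: if `card ι` commuting families of `k + 1` sets are such that
all the proper subfamilies are elliptic, then one of them is elliptic, provided that the dimension
is less than `card ι * k`. -/
theorem IsCAT0.exists_elliptic_of_commuting_families [Nonempty X] (h : IsCAT0 X) {d k : ℕ}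
    (hd : HasCoveringDimLE X d) {ι κ : Type*} [Fintype ι] [Fintype κ]
    (hκ : Fintype.card κ = k + 1)
    (hdc : d < Fintype.card ι * k) (S : ι → κ → Set G)
    (hc : ∀ i j, i ≠ j → ∀ a b, ∀ f ∈ S i a, ∀ g ∈ S j b, Commute f g)
    (hS : ∀ i a, Elliptic X (⋃ b ∈ {b | b ≠ a}, S i b)) :
    ∃ i, Elliptic X (⋃ a, S i a) := by
  let e := (Fintype.equivFin ι).symm
  let e' : Fin (k + 1) ≃ κ := ((Fintype.equivFin κ).trans (finCongr hκ)).symm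
  obtain ⟨i, x, hx⟩ := h.exists_inter_nonempty hd hdc
    (fun i a => {x : X | ∀ g ∈ S (e i) (e' a), g • x = x}) (fun _ _ => isClosed_fixed _)
    (fun i a x hx y hy s g hg => h.smul_geo (hx g hg) (hy g hg) s) (fun α => by
      obtain ⟨x, hx⟩ := h.elliptic_iUnion_of_commute
        (S := fun i => ⋃ b ∈ {b | b ≠ e' (α i)}, S (e i) b) (fun i => hS _ _) (by
          intro i j hij f hf g hg
          obtain ⟨a, -, hfa⟩ := Set.mem_iUnion₂.mp hf
          obtain ⟨b, -, hgb⟩ := Set.mem_iUnion₂.mp hg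
          exact hc _ _ (e.injective.ne hij) a b f hfa g hgb)
      exact ⟨x, fun i b hb g hg => hx g (Set.mem_iUnion.mpr
        ⟨i, Set.mem_iUnion₂.mpr ⟨e' b, e'.injective.ne hb, hg⟩⟩)⟩)
  refine ⟨e i, x, fun g hg => ?_⟩
  obtain ⟨a, ha⟩ := Set.mem_iUnion.mp hg
  exact hx (e'.symm a) g (by simpa using ha)

end Elliptic

/-! ### Cancellation in free groups: common prefixes and Gromov products. -/

section CommonPrefix

variable {β : Type*} [DecidableEq β]

/-- The length of the longest common prefix of two lists. -/
def lcp : List β → List β → ℕ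
  | a :: l, b :: m => if a = b then lcp l m + 1 else 0
  | _, _ => 0

theorem le_lcp_iff (l m : List β) (k : ℕ) :
    k ≤ lcp l m ↔ k ≤ l.length ∧ k ≤ m.length ∧ l.take k = m.take k := by
  induction k generalizing l m with
  | zero => simp
  | succ k ih =>
    rcases l with _ | ⟨a, l⟩
    · simp [lcp]
    rcases m with _ | ⟨b, m⟩
    · simp [lcp]
    rw [lcp]
    split_ifs with h
    · simp [ih, h]
    · simp [h]

theorem lcp_comm (l m : List β) : lcp l m = lcp m l := by
  refine eq_of_forall_le_iff fun k => ?_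
  rw [le_lcp_iff, le_lcp_iff, eq_comm]
  tauto

theorem min_lcp_le (l m p : List β) : min (lcp l m) (lcp m p) ≤ lcp l p := by
  obtain ⟨h1, h2, h3⟩ := (le_lcp_iff l m _).mp (min_le_left (lcp l m) (lcp m p))
  obtain ⟨h4, h5, h6⟩ := (le_lcp_iff m p _).mp (min_le_right (lcp l m) (lcp m p))
  exact (le_lcp_iff l p _).mpr ⟨h1, h5, h3.trans h6⟩

end CommonPrefix

namespace FreeGroup

variable {α : Type*} [DecidableEq α]

/-- The Gromov product in the Cayley tree: the length of the longest common prefix of the reduced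
words. -/
def gromov (g h : FreeGroup α) : ℕ := lcp g.toWord h.toWord

theorem gromov_comm (g h : FreeGroup α) : gromov g h = gromov h g := lcp_comm _ _

theorem min_gromov_le (f g h : FreeGroup α) : min (gromov f g) (gromov g h) ≤ gromov f h :=
  min_lcp_le _ _ _

theorem isReduced_invRev_append {l m : List (α × Bool)} (hl : IsReduced l) (hm : IsReduced m)
    (h : ∀ a ∈ l.head?, ∀ b ∈ m.head?, a ≠ b) : IsReduced (invRev l ++ m) := by
  refine List.IsChain.append ?_ hm ?_
  · have : IsReduced (invRev l) := by
      rw [isReduced_iff_reduce_eq, reduce_invRev, hl.reduce_eq]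
    exact this
  · intro x hx y hy hxy
    have hx' : (x.1, !x.2) ∈ l.head? := by
      rcases l with _ | ⟨a, l⟩
      · simp at hx
      · simp [invRev] at hx
        simp [← hx]
    have hne := h _ hx' y hy
    rcases x with ⟨x, c⟩
    rcases y with ⟨y, e⟩
    cases c <;> cases e <;> simp_all

theorem norm_mk_inv_mul_mk (l m : List (α × Bool)) (hl : IsReduced l) (hm : IsReduced m) :
    norm ((mk l)⁻¹ * mk m) + 2 * lcp l m = l.length + m.length := by
  induction l generalizing m with
  | nil => rw [inv_mk, mul_mk, norm, toWord_mk]; simp [lcp, hm.reduce_eq]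
  | cons a l ih =>
    have key : lcp (a :: l) m = 0 → (∀ b ∈ m.head?, a ≠ b) →
        norm ((mk (a :: l))⁻¹ * mk m) + 2 * lcp (a :: l) m = (a :: l).length + m.length := by
      intro h0 hne
      rw [h0, inv_mk, mul_mk, norm, toWord_mk,
        (isReduced_invRev_append hl hm (by simpa using hne)).reduce_eq, List.length_append,
        invRev_length, mul_zero, add_zero]
    rcases m with _ | ⟨b, m⟩
    · exact key rfl (by simp)
    by_cases hab : a = b
    · subst hab
      have hl' : IsReduced l := hl.infix ⟨[a], [], by simp⟩
      have hm' : IsReduced m := hm.infix ⟨[a], [], by simp⟩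
      have e : (mk (a :: l))⁻¹ * mk (a :: m) = (mk l)⁻¹ * mk m := by
        rw [← List.singleton_append, ← mul_mk, ← List.singleton_append (l := m), ← mul_mk]
        group
      rw [e, lcp, if_pos rfl]
      have := ih m hl' hm'
      simp only [List.length_cons]
      omega
    · exact key (by simp [lcp, hab]) (by simpa using hab)

theorem norm_inv_mul (g h : FreeGroup α) :
    norm (g⁻¹ * h) + 2 * gromov g h = norm g + norm h := by
  have := norm_mk_inv_mul_mk g.toWord h.toWord isReduced_toWord isReduced_toWord
  rwa [mk_toWord, mk_toWord] at this

theorem norm_mul_add (g h : FreeGroup α) :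
    norm (g * h) + 2 * gromov g⁻¹ h = norm g + norm h := by
  have := norm_inv_mul g⁻¹ h
  rwa [inv_inv, norm_inv_eq] at this

/-- Write g = c r c⁻¹ with r cyclically reduced: squaring doubles r and keeps c. -/
theorem norm_le_norm_mul_self (g : FreeGroup α) : norm g ≤ norm (g * g) := by
  have h1 := reduceCyclically.reduce_flatten_replicate_succ
    (isReduced_toWord (x := g)) 1
  have h2 := congrArg List.length (reduceCyclically.conj_conjugator_reduceCyclically g.toWord)
  rw [norm, norm, toWord_mul]
  have h3 := congrArg List.length h1
  simp [List.replicate_succ] at h2 h3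
  omega

/-- The estimate behind Nielsen's method: products along a Nielsen reduced family are at least as
long as the number of their factors. -/
theorem length_le_norm_prod {L : Type*} (val : L → FreeGroup α) (R : L → L → Prop)
    (hpos : ∀ a, 0 < norm (val a))
    (h1 : ∀ a b, R a b → 2 * gromov (val a)⁻¹ (val b) ≤ norm (val a) ∧
      2 * gromov (val a)⁻¹ (val b) ≤ norm (val b))
    (h2 : ∀ a b c, R a b → R b c →
      gromov (val a)⁻¹ (val b) + gromov (val b)⁻¹ (val c) < norm (val b))
    (l : List L) (hl : l.IsChain R) : l.length ≤ norm (l.map val).prod := by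
  -- Here `P` is a partial product with last factor `a`, and the Gromov product of `P⁻¹` and `(val
  -- a)⁻¹` is the length of their common suffix. The next factor cancels strictly less than this
  -- suffix, so each step gains at least one letter.
  have key : ∀ (l : List L) (P : FreeGroup α) (a : L), (a :: l).IsChain R →
      (∀ b, R a b → gromov (val a)⁻¹ (val b) < gromov P⁻¹ (val a)⁻¹) →
      1 ≤ gromov P⁻¹ (val a)⁻¹ →
      norm P + l.length + 1 ≤ norm (P * (l.map val).prod) + gromov P⁻¹ (val a)⁻¹ := by
    intro l
    induction l with
    | nil => intro P a _ _ h; simpa using h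
    | cons b l ih =>
      intro P a hal hlt hge
      obtain ⟨hab, hbl⟩ := List.isChain_cons_cons.mp hal
      have hab' := hlt b hab
      -- The ultrametric inequality: the next factor sees only the common suffix of `P` and `val a`.
      have e1 : gromov P⁻¹ (val b) = gromov (val a)⁻¹ (val b) := by
        have i1 := min_gromov_le P⁻¹ (val a)⁻¹ (val b)
        have i2 := min_gromov_le (val a)⁻¹ P⁻¹ (val b)
        rw [gromov_comm (val a)⁻¹ P⁻¹] at i2
        omega
      have e2 := norm_mul_add P (val b)
      have e3 := norm_mul_add (P * val b) (val b)⁻¹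
      rw [mul_inv_cancel_right, norm_inv_eq] at e3
      have := ih (P * val b) b hbl (fun c hbc => by
        have := h2 a b c hab hbc
        omega) (by
        have := (h1 a b hab).2
        have := hpos b
        rw [e1] at e2
        omega)
      simp only [List.map_cons, List.prod_cons, List.length_cons, ← mul_assoc]
      omega
  rcases l with _ | ⟨a, l⟩
  · simp
  have hs : gromov (val a)⁻¹ (val a)⁻¹ = norm (val a) := by
    have := norm_inv_mul (val a)⁻¹ (val a)⁻¹
    rw [inv_mul_cancel, norm_one, norm_inv_eq] at this
    omega
  have := key l (val a) a hl (fun b hab => by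
    have := (h1 a b hab).1
    have := hpos a
    omega) (by rw [hs]; exact hpos a)
  rw [hs] at this
  simp only [List.map_cons, List.prod_cons, List.length_cons]
  omega

end FreeGroup

/-! ### Nielsen automorphisms. -/

namespace FreeGroup

variable {α : Type*} [DecidableEq α]

section Automorphisms

/-- The automorphism that multiplies the generator `i` on the right by the generator `j ≠ i`. -/
def rho (i j : α) : MulAut (FreeGroup α) :=
  if h : i = j then 1 else
    MonoidHom.toMulEquiv (lift fun k => if k = i then of i * of j else of k)
      (lift fun k => if k = i then of i * (of j)⁻¹ else of k)
      (by ext k; by_cases hk : k = i <;> simp [hk, Ne.symm h])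
      (by ext k; by_cases hk : k = i <;> simp [hk, Ne.symm h])

theorem rho_of {i j : α} (h : i ≠ j) (k : α) :
    rho i j (of k) = if k = i then of i * of j else of k := by
  simp [rho, h]

theorem rho_inv_of {i j : α} (h : i ≠ j) (k : α) :
    (rho i j)⁻¹ (of k) = if k = i then of i * (of j)⁻¹ else of k := by
  rw [MulAut.inv_def, MulEquiv.symm_apply_eq]
  split_ifs with hk
  · rw [_root_.map_mul, _root_.map_inv, rho_of h, rho_of h, if_pos rfl, if_neg h.symm,
      mul_inv_cancel_right, hk]
  · rw [rho_of h, if_neg hk]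

theorem rho_symm_of {i j : α} (h : i ≠ j) (k : α) :
    (rho i j).symm (of k) = if k = i then of i * (of j)⁻¹ else of k :=
  rho_inv_of h k

/-- The automorphism that inverts the generator `i`. -/
def invGen (i : α) : MulAut (FreeGroup α) :=
  MonoidHom.toMulEquiv (lift fun k => if k = i then (of i)⁻¹ else of k)
    (lift fun k => if k = i then (of i)⁻¹ else of k)
    (by ext k; by_cases hk : k = i <;> simp [hk])
    (by ext k; by_cases hk : k = i <;> simp [hk])

theorem invGen_of (i k : α) : invGen i (of k) = if k = i then (of i)⁻¹ else of k := by
  simp [invGen]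

omit [DecidableEq α] in
theorem mulAut_ext {f g : MulAut (FreeGroup α)} (h : ∀ k, f (of k) = g (of k)) : f = g := by
  have : f.toMonoidHom = g.toMonoidHom := FreeGroup.ext_hom _ _ h
  ext x
  exact DFunLike.congr_fun this x

theorem invGen_mul_self (i : α) : invGen i * invGen i = 1 := by
  refine mulAut_ext fun k => ?_
  by_cases hk : k = i <;> simp [invGen_of, hk]

theorem invGen_inv (i : α) : (invGen i)⁻¹ = invGen i :=
  inv_eq_of_mul_eq_one_left (invGen_mul_self i)

/-- The automorphisms that permute the generators. -/
def permAut (α : Type*) : Equiv.Perm α →* MulAut (FreeGroup α) where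
  toFun σ := freeGroupCongr σ
  map_one' := mulAut_ext fun k => by simp
  map_mul' σ τ := mulAut_ext fun k => by simp

omit [DecidableEq α] in
theorem permAut_of (σ : Equiv.Perm α) (k : α) : permAut α σ (of k) = of (σ k) := by
  simp [permAut]

variable (α) in
/-- The set of Nielsen automorphisms. -/
def nielsenSet : Set (MulAut (FreeGroup α)) :=
  {g | ∃ i j, i ≠ j ∧ g = rho i j} ∪ Set.range invGen ∪ Set.range (permAut α)

theorem rho_mem {i j : α} (h : i ≠ j) : rho i j ∈ Subgroup.closure (nielsenSet α) :=
  Subgroup.subset_closure (Or.inl (Or.inl ⟨i, j, h, rfl⟩))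

theorem invGen_mem (i : α) : invGen i ∈ Subgroup.closure (nielsenSet α) :=
  Subgroup.subset_closure (Or.inl (Or.inr ⟨i, rfl⟩))

omit [DecidableEq α] in
theorem mk_singleton_true (i : α) : mk [(i, true)] = of i := rfl

omit [DecidableEq α] in
theorem mk_singleton_false (i : α) : mk [(i, false)] = (of i)⁻¹ := rfl

/-- The elementary Nielsen move for letters instead of generators, which confines the case
distinction on signs to this lemma. -/
theorem exists_nielsen_mul (b c : α × Bool) (h : b.1 ≠ c.1) :
    ∃ ν ∈ Subgroup.closure (nielsenSet α), ν (mk [c]) = mk [b] * mk [c] ∧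
      ∀ k, k ≠ c.1 → ν (of k) = of k := by
  obtain ⟨j, b⟩ := b
  obtain ⟨i, c⟩ := c
  simp only at h
  have h' := Ne.symm h
  rcases b with _ | _ <;> rcases c with _ | _ <;>
    simp only [mk_singleton_true, mk_singleton_false, _root_.map_inv]
  · exact ⟨rho i j, rho_mem h', by simp [rho_of h'], fun k hk => by simp [rho_of h', hk]⟩
  · refine ⟨invGen i * rho i j * invGen i,
      mul_mem (mul_mem (invGen_mem i) (rho_mem h')) (invGen_mem i),
      by simp [rho_of h', invGen_of, h], fun k hk => by simp [rho_of h', invGen_of, hk]⟩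
  · exact ⟨(rho i j)⁻¹, inv_mem (rho_mem h'), by simp [rho_symm_of h'],
      fun k hk => by simp [rho_symm_of h', hk]⟩
  · refine ⟨invGen i * (rho i j)⁻¹ * invGen i,
      mul_mem (mul_mem (invGen_mem i) (inv_mem (rho_mem h'))) (invGen_mem i),
      by simp [rho_symm_of h', invGen_of, h],
      fun k hk => by simp [rho_symm_of h', invGen_of, hk]⟩

end Automorphisms

/-! ### A tie-breaking code for words. -/

section Code

variable [Fintype α]

/-- A numerical code for words, refining the lexicographic order on words of the same length. -/
noncomputable def wordCode (l : List (α × Bool)) : ℕ :=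
  -- The reversal below makes the first letter the most significant digit. The summand 2 keeps the
  -- base above 1 even for an empty alphabet.
  Nat.ofDigits (Fintype.card (α × Bool) + 2)
    ((l.map fun a => (Fintype.equivFin (α × Bool) a : ℕ)).reverse)

omit [DecidableEq α] in
theorem wordCode_append (l m : List (α × Bool)) :
    wordCode (l ++ m) = wordCode m + (Fintype.card (α × Bool) + 2) ^ m.length * wordCode l := by
  simp [wordCode, Nat.ofDigits_append]

omit [DecidableEq α] in
theorem wordCode_lt (l : List (α × Bool)) :
    wordCode l < (Fintype.card (α × Bool) + 2) ^ l.length := by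
  have := Nat.ofDigits_lt_base_pow_length (b := Fintype.card (α × Bool) + 2) (by omega)
    (l := (l.map fun a => (Fintype.equivFin (α × Bool) a : ℕ)).reverse) (by
      intro x hx
      simp only [List.mem_reverse, List.mem_map] at hx
      obtain ⟨a, -, rfl⟩ := hx
      exact (Fin.is_lt _).trans (by omega))
  simpa [wordCode] using this

omit [DecidableEq α] in
theorem wordCode_inj {l m : List (α × Bool)} (hlen : l.length = m.length)
    (h : wordCode l = wordCode m) : l = m := by
  induction l generalizing m with
  | nil => exact (List.length_eq_zero_iff.mp hlen.symm).symm
  | cons a l ih =>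
    rcases m with _ | ⟨b, m⟩
    · simp at hlen
    have hlen' : l.length = m.length := by simpa using hlen
    rw [← List.singleton_append, wordCode_append, ← List.singleton_append (l := m),
      wordCode_append, hlen'] at h
    have h1 := wordCode_lt l
    have h2 := wordCode_lt m
    rw [hlen'] at h1
    set B := (Fintype.card (α × Bool) + 2) ^ m.length
    have h3 : wordCode l = wordCode m := by
      have := congrArg (· % B) h
      simpa [Nat.add_mul_mod_self_left, Nat.mod_eq_of_lt h1, Nat.mod_eq_of_lt h2] using this
    have h4 : wordCode [a] = wordCode [b] := by
      rw [h3] at h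
      exact Nat.eq_of_mul_eq_mul_left (by omega) (Nat.add_left_cancel h)
    have h5 : a = b := by
      simpa [wordCode, Fin.val_inj] using h4
    rw [h5, ih hlen' h3]

omit [DecidableEq α] in
/-- Replacing the initial segment of a word by a smaller one of the same length decreases the sum
of the codes of the word and its inverse. -/
theorem wordCode_add_invRev_lt {p q c : List (α × Bool)} (hlen : p.length = q.length)
    (hc : q.length ≤ c.length) (h : wordCode p < wordCode q) :
    wordCode (p ++ c) + wordCode (invRev (p ++ c)) <
      wordCode (q ++ c) + wordCode (invRev (q ++ c)) := by
  rw [invRev_append, invRev_append, wordCode_append p, wordCode_append q,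
    wordCode_append _ (invRev p), wordCode_append _ (invRev q), invRev_length, invRev_length, hlen]
  have h1 := wordCode_lt (invRev p)
  rw [invRev_length, hlen] at h1
  -- Changing the prefix of the word lowers its code by at least the base to the power |c|; changing
  -- the suffix of the inverse word raises its code by less than the base to the power |q|.
  have h2 : (Fintype.card (α × Bool) + 2) ^ q.length ≤ (Fintype.card (α × Bool) + 2) ^ c.length :=
    Nat.pow_le_pow_right (by omega) hc
  set B := (Fintype.card (α × Bool) + 2) ^ c.length
  have h3 : B * (wordCode p + 1) ≤ B * wordCode q := Nat.mul_le_mul_left _ h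
  rw [mul_add, mul_one] at h3
  omega

end Code
end FreeGroup

/-! ### Nielsen reduction and generation of the automorphism group. -/

namespace FreeGroup

variable {α : Type*} [DecidableEq α] [Fintype α]

/-- The sum of a function over the images of the generators. -/
def basisSum (F : FreeGroup α → ℕ) (ψ : MulAut (FreeGroup α)) : ℕ := ∑ i, F (ψ (of i))

omit [DecidableEq α] [Fintype α] in
theorem apply_letter_eq {F : FreeGroup α → ℕ} (hF : ∀ g, F g⁻¹ = F g) (ψ : MulAut (FreeGroup α))
    (c : α × Bool) : F (ψ (of c.1)) = F (ψ (mk [c])) := by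
  obtain ⟨i, c⟩ := c
  cases c
  · rw [mk_singleton_false, _root_.map_inv, hF]
  · rfl

theorem basisSum_mul {F : FreeGroup α → ℕ} (hF : ∀ g, F g⁻¹ = F g) (ψ ν : MulAut (FreeGroup α))
    (c : α × Bool) (hν : ∀ k, k ≠ c.1 → ν (of k) = of k) :
    basisSum F (ψ * ν) + F (ψ (mk [c])) = basisSum F ψ + F (ψ (ν (mk [c]))) := by
  have h1 := apply_letter_eq hF ψ c
  have h2 := apply_letter_eq hF (ψ * ν) c
  rw [basisSum, basisSum, ← Finset.add_sum_erase _ _ (Finset.mem_univ c.1),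
    ← Finset.add_sum_erase _ (fun i => F (ψ (of i))) (Finset.mem_univ c.1), h1, h2,
    MulAut.mul_apply]
  have : ∑ x ∈ Finset.univ.erase c.1, F ((ψ * ν) (of x)) =
      ∑ x ∈ Finset.univ.erase c.1, F (ψ (of x)) :=
    Finset.sum_congr rfl fun k hk => by rw [MulAut.mul_apply, hν k (Finset.ne_of_mem_erase hk)]
  rw [this]
  ring

/-- The sum of the codes of an element and its inverse. -/
noncomputable def symCode (g : FreeGroup α) : ℕ := wordCode g.toWord + wordCode g⁻¹.toWord

theorem symCode_inv (g : FreeGroup α) : symCode g⁻¹ = symCode g := by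
  rw [symCode, symCode, inv_inv, add_comm]

/-- A lexicographic minimum: total length first, then total code. Length alone does not exclude a
basis element whose two halves both cancel against neighbours. -/
theorem exists_minimal_mul (φ : MulAut (FreeGroup α)) :
    ∃ ν ∈ Subgroup.closure (nielsenSet α), ∀ μ ∈ Subgroup.closure (nielsenSet α),
      basisSum norm (φ * ν) ≤ basisSum norm (φ * ν * μ) ∧
      (basisSum norm (φ * ν * μ) = basisSum norm (φ * ν) →
        basisSum symCode (φ * ν) ≤ basisSum symCode (φ * ν * μ)) := by
  let f : MulAut (FreeGroup α) → ℕ ×ₗ ℕ := fun ν =>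
    toLex (basisSum norm (φ * ν), basisSum symCode (φ * ν))
  obtain ⟨ν, hν, hmin⟩ := (InvImage.wf f wellFounded_lt).has_min
    (Subgroup.closure (nielsenSet α) : Set (MulAut (FreeGroup α))) ⟨1, one_mem _⟩
  refine ⟨ν, hν, fun μ hμ => ?_⟩
  have := hmin (ν * μ) (mul_mem hν hμ)
  simp only [InvImage, f, Prod.Lex.toLex_lt_toLex, ← mul_assoc] at this
  push Not at this
  exact ⟨this.1, this.2⟩

section Minimal

variable {ψ : MulAut (FreeGroup α)}

omit [DecidableEq α] [Fintype α] in
theorem mk_inv_letter (b : α × Bool) : mk [(b.1, !b.2)] = (mk [b])⁻¹ := by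
  rw [inv_mk]; rfl

/-- A Nielsen move replaces a single basis image by the product, which minimality forbids to be
shorter. When the two letters agree there is no such move, and the bound for squares applies. -/
theorem norm_le_norm_letter_mul (hψ : ∀ μ ∈ Subgroup.closure (nielsenSet α),
      basisSum norm ψ ≤ basisSum norm (ψ * μ)) {b c : α × Bool} (h : b.1 = c.1 → b.2 = c.2) :
    norm (ψ (mk [c])) ≤ norm (ψ (mk [b]) * ψ (mk [c])) ∧
      norm (ψ (mk [b])) ≤ norm (ψ (mk [b]) * ψ (mk [c])) := by
  by_cases hbc : b.1 = c.1
  · rw [Prod.ext hbc (h hbc)]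
    exact ⟨norm_le_norm_mul_self _, norm_le_norm_mul_self _⟩
  · have key : ∀ b c : α × Bool, b.1 ≠ c.1 →
        norm (ψ (mk [c])) ≤ norm (ψ (mk [b]) * ψ (mk [c])) := by
      intro b c hbc
      obtain ⟨ν, hν, hνc, hνk⟩ := exists_nielsen_mul b c hbc
      have h1 := basisSum_mul (F := norm) (fun g => norm_inv_eq) ψ ν c hνk
      have h2 := hψ ν hν
      rw [hνc, _root_.map_mul] at h1
      omega
    refine ⟨key b c hbc, ?_⟩
    have := key (c.1, !c.2) (b.1, !b.2) (Ne.symm hbc)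
    rwa [mk_inv_letter, mk_inv_letter, _root_.map_inv, _root_.map_inv, norm_inv_eq, ← mul_inv_rev,
      norm_inv_eq] at this

omit [Fintype α] in
theorem toWord_eq_of_norm {g : FreeGroup α} {l : List (α × Bool)} (h : g = mk l)
    (hl : l.length ≤ norm g) : g.toWord = l := by
  subst h
  rw [norm, toWord_mk] at hl
  rw [toWord_mk]
  exact (reduce.red (L := l)).sublist.eq_of_length_le hl

/-- When the second half of the image of `b` cancels completely against the image of `c`,
multiplying the two preserves length and replaces a prefix of the latter by the first half of the
former. Minimality of the code then compares the two prefixes. -/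
theorem wordCode_take_le (hψ : ∀ μ ∈ Subgroup.closure (nielsenSet α),
      basisSum norm ψ ≤ basisSum norm (ψ * μ) ∧
      (basisSum norm (ψ * μ) = basisSum norm ψ → basisSum symCode ψ ≤ basisSum symCode (ψ * μ)))
    {b c : α × Bool} (h : b.1 = c.1 → b.2 = c.2) {m : ℕ} (hm : norm (ψ (mk [b])) = 2 * m)
    (hbc : m ≤ gromov (ψ (mk [b]))⁻¹ (ψ (mk [c]))) :
    wordCode ((ψ (mk [b]))⁻¹.toWord.take m) ≤ wordCode ((ψ (mk [b])).toWord.take m) := by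
  have hle := norm_le_norm_letter_mul (fun μ hμ => (hψ μ hμ).1) h
  obtain ⟨hm1, hm2, hm3⟩ := (le_lcp_iff _ _ _).mp hbc
  by_cases hbc' : b.1 = c.1
  · rw [hm3, ← Prod.ext hbc' (h hbc')]
  obtain ⟨ν, hν, hνc, hνk⟩ := exists_nielsen_mul b c hbc'
  have e1 := basisSum_mul (F := norm) (fun g => norm_inv_eq) ψ ν c hνk
  have e2 := basisSum_mul (F := symCode) symCode_inv ψ ν c hνk
  rw [hνc, _root_.map_mul] at e1 e2
  set B := ψ (mk [b])
  set C := ψ (mk [c])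
  set p := B.toWord.take m with hp
  set q := B⁻¹.toWord.take m with hq
  set r := B.toWord.drop m
  set s := C.toWord.drop m with hs
  have hBl : B.toWord.length = 2 * m := hm
  have hlp : p.length = m := by simp [hp]; omega
  have hlq : q.length = m := by simp [hq]; omega
  have hqr : q = invRev r := by
    have h1 : B.toWord = p ++ r := (List.take_append_drop _ _).symm
    have h2 : (invRev r).length = m := by
      have := congrArg List.length h1
      rw [List.length_append] at this
      rw [invRev_length]; omega
    rw [hq, toWord_inv, h1, invRev_append, List.take_left' h2]
  have hC : C.toWord = q ++ s := by rw [hm3, hs, List.take_append_drop]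
  have hBC : B * C = mk (p ++ s) := by
    have hB : B.toWord = p ++ r := (List.take_append_drop _ _).symm
    rw [← mk_toWord (x := B), ← mk_toWord (x := C), hC, hB, hqr, ← mul_mk, ← mul_mk, ← mul_mk,
      ← inv_mk, mul_assoc, mul_inv_cancel_left]
  have hnC : norm C = m + s.length := by rw [norm, hC, List.length_append, hlq]
  have hw : (B * C).toWord = p ++ s := by
    refine toWord_eq_of_norm hBC ?_
    rw [List.length_append, hlp, ← hnC]
    exact hle.1
  have hnBC : norm (B * C) = m + s.length := by rw [norm, hw, List.length_append, hlp]
  have h3 := (hψ ν hν).2 (by omega)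
  by_contra! hlt
  have h4 := wordCode_add_invRev_lt (c := s) (by rw [hlp, hlq]) (by
    have := hle.2
    omega) hlt
  have h5 : symCode (B * C) < symCode C := by
    rw [symCode, symCode, toWord_inv, toWord_inv, hw, hC]
    exact h4
  omega

end Minimal

/-- The images of a minimal automorphism are Nielsen reduced, so a product of m of them along a
reduced word has length at least m. Expressing a generator, of length 1, leaves room for a single
letter. -/
theorem exists_letter_of_minimal {ψ : MulAut (FreeGroup α)}
    (hψ : ∀ μ ∈ Subgroup.closure (nielsenSet α),
      basisSum norm ψ ≤ basisSum norm (ψ * μ) ∧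
      (basisSum norm (ψ * μ) = basisSum norm ψ → basisSum symCode ψ ≤ basisSum symCode (ψ * μ)))
    (j : α) : ∃ a, ψ⁻¹ (of j) = mk [a] := by
  set val : α × Bool → FreeGroup α := fun a => ψ (mk [a]) with hval
  have hpos : ∀ a, 0 < norm (val a) := by
    intro a
    rw [Nat.pos_iff_ne_zero, Ne, norm_eq_zero]
    intro h
    have h1 : mk [a] = 1 := (map_eq_one_iff ψ ψ.injective).mp h
    have h2 := congrArg norm h1
    simp [norm] at h2
  have hN1 : ∀ a b : α × Bool, (a.1 = b.1 → a.2 = b.2) →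
      2 * gromov (val a)⁻¹ (val b) ≤ norm (val a) ∧
        2 * gromov (val a)⁻¹ (val b) ≤ norm (val b) := by
    intro a b hab
    have h1 := norm_le_norm_letter_mul (fun μ hμ => (hψ μ hμ).1) hab
    have h2 := norm_mul_add (val a) (val b)
    simp only [hval] at *
    omega
  have hN2 : ∀ a b c : α × Bool, (a.1 = b.1 → a.2 = b.2) → (b.1 = c.1 → b.2 = c.2) →
      gromov (val a)⁻¹ (val b) + gromov (val b)⁻¹ (val c) < norm (val b) := by
    intro a b c hab hbc
    by_contra! hcon
    have h1 := hN1 a b hab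
    have h2 := hN1 b c hbc
    obtain ⟨m, hm⟩ : ∃ m, norm (val b) = 2 * m := ⟨gromov (val b)⁻¹ (val c), by omega⟩
    have h3 := wordCode_take_le hψ hbc hm (by simp only [hval] at *; omega)
    have hinv : ψ (mk [(b.1, !b.2)]) = (val b)⁻¹ := by rw [mk_inv_letter, _root_.map_inv]
    have hinva : ψ (mk [(a.1, !a.2)]) = (val a)⁻¹ := by rw [mk_inv_letter, _root_.map_inv]
    -- The same comparison for the inverse letter gives the reverse inequality. The two prefixes
    -- then coincide, which makes the image of `b` trivial.
    have h4 := wordCode_take_le (b := (b.1, !b.2)) (c := (a.1, !a.2)) hψ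
      (fun h => by simpa using (hab h.symm).symm) (m := m)
      (by rw [hinv, norm_inv_eq, hm]) (by
        rw [hinv, hinva, inv_inv, gromov_comm]
        omega)
    rw [hinv, inv_inv] at h4
    have hl : (val b).toWord.length = 2 * m := hm
    have h5 : (val b)⁻¹.toWord.take m = (val b).toWord.take m := by
      refine wordCode_inj ?_ (le_antisymm h3 h4)
      rw [List.length_take, List.length_take, toWord_inv, invRev_length]
    have h6 : m ≤ gromov (val b)⁻¹ (val b) := by
      refine (le_lcp_iff _ _ _).mpr ⟨?_, by omega, h5⟩
      rw [toWord_inv, invRev_length]; omega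
    have h7 := norm_mul_add (val b) (val b)
    have h8 := norm_le_norm_mul_self (val b)
    have h9 : val b = mk ((val b).toWord.take m) * mk ((val b).toWord.drop m) := by
      rw [mul_mk, List.take_append_drop, mk_toWord]
    have h10 : mk ((val b).toWord.drop m) = (mk ((val b).toWord.take m))⁻¹ := by
      rw [← h5, toWord_inv, inv_mk]
      have h11 : invRev (val b).toWord =
          invRev ((val b).toWord.drop m) ++ invRev ((val b).toWord.take m) := by
        rw [← invRev_append, List.take_append_drop]
      rw [h11, List.take_left' (by rw [invRev_length, List.length_drop]; omega), invRev_invRev]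
    rw [h10, mul_inv_cancel] at h9
    have := hpos b
    rw [h9, norm_one] at this
    exact lt_irrefl _ this
  have hlen := length_le_norm_prod val (fun a b => a.1 = b.1 → a.2 = b.2) hpos hN1 hN2
    (ψ⁻¹ (of j)).toWord isReduced_toWord
  have hprod : ∀ l : List (α × Bool), (l.map val).prod = ψ (mk l) := by
    intro l
    induction l with
    | nil => exact (_root_.map_one ψ).symm
    | cons a l ih =>
      rw [List.map_cons, List.prod_cons, ih, hval, ← _root_.map_mul, mul_mk, List.singleton_append]
  rw [hprod, mk_toWord, MulAut.apply_inv_self, norm_of] at hlen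
  have hne : (ψ⁻¹ (of j)).toWord ≠ [] := by
    rw [Ne, toWord_eq_nil_iff]
    intro h
    exact of_ne_one j ((map_eq_one_iff ψ⁻¹ (ψ⁻¹).injective).mp h)
  obtain ⟨a, ha⟩ := List.length_eq_one_iff.mp
    (le_antisymm hlen (List.length_pos_of_ne_nil hne))
  exact ⟨a, by rw [← ha, mk_toWord]⟩

omit [Fintype α] in
theorem exists_invGen_finset (s : Finset α) : ∃ ν ∈ Subgroup.closure (nielsenSet α),
    ∀ k, ν (of k) = if k ∈ s then (of k)⁻¹ else of k := by
  induction s using Finset.induction_on with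
  | empty => exact ⟨1, one_mem _, by simp⟩
  | insert a s ha ih =>
    obtain ⟨ν, hν, h⟩ := ih
    refine ⟨invGen a * ν, mul_mem (invGen_mem a) hν, fun k => ?_⟩
    rw [MulAut.mul_apply, h]
    by_cases hks : k ∈ s
    · have : k ≠ a := fun e => ha (e ▸ hks)
      simp [hks, invGen_of, this]
    · by_cases hka : k = a
      · subst hka
        simp [hks, invGen_of]
      · simp [hks, invGen_of, hka]

/-- Nielsen's theorem: the automorphism group of a free group of finite rank is generated by the
Nielsen automorphisms. -/
theorem closure_nielsenSet : Subgroup.closure (nielsenSet α) = ⊤ := by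
  rw [eq_top_iff]
  intro φ _
  obtain ⟨ν, hν, hmin⟩ := exists_minimal_mul φ
  set ψ := φ * ν
  choose a ha using exists_letter_of_minimal hmin
  have hinj : Function.Injective fun j => (a j).1 := by
    intro j k hjk
    have h1 : ψ⁻¹ (of j) = ψ⁻¹ (of k) ∨ ψ⁻¹ (of j) = ψ⁻¹ (of k)⁻¹ := by
      rw [_root_.map_inv, ha, ha, ← mk_inv_letter]
      by_cases h : (a j).2 = (a k).2
      · left; rw [Prod.ext hjk h]
      · right
        have : a j = ((a k).1, !(a k).2) := Prod.ext hjk (by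
          revert h; cases (a j).2 <;> cases (a k).2 <;> simp)
        rw [this]
    rcases h1 with h1 | h1
    · exact of_injective ((ψ⁻¹).injective h1)
    · have h2 := congrArg toWord ((ψ⁻¹).injective h1)
      rw [← mk_singleton_false, toWord_of, toWord_mk] at h2
      simp at h2
  let τ : Equiv.Perm α := Equiv.ofBijective _ (Finite.injective_iff_bijective.mp hinj)
  obtain ⟨μ, hμ, hμk⟩ := exists_invGen_finset (Finset.univ.filter fun i => (a i).2 = false)
  have e : ψ⁻¹ = permAut α τ * μ := by
    refine mulAut_ext fun j => ?_
    rw [ha, MulAut.mul_apply, hμk]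
    simp only [Finset.mem_filter, Finset.mem_univ, true_and]
    have hτ : τ j = (a j).1 := rfl
    split_ifs with h
    · rw [_root_.map_inv, permAut_of, hτ, ← mk_singleton_false, ← h]
    · rw [permAut_of, hτ, ← mk_singleton_true, ← Bool.of_not_eq_false h]
  have hψ : ψ ∈ Subgroup.closure (nielsenSet α) := by
    rw [← inv_mem_iff, e]
    exact mul_mem (Subgroup.subset_closure (Or.inr ⟨τ, rfl⟩)) hμ
  have : φ = ψ * ν⁻¹ := by simp [ψ]
  rw [this]
  exact mul_mem hψ (inv_mem hν)

end FreeGroup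

set_option linter.unusedSimpArgs false

namespace FreeGroup

variable {α : Type*} [DecidableEq α]

/-! ### Identities between transvections, inversions and permutations. -/

section Identities

/-- The automorphism that multiplies the generator `i` on the left by the generator `j ≠ i`. -/
def lam (i j : α) : MulAut (FreeGroup α) := invGen i * (rho i j)⁻¹ * invGen i

theorem lam_of {i j : α} (h : i ≠ j) (k : α) :
    lam i j (of k) = if k = i then of j * of i else of k := by
  by_cases hk : k = i <;> simp [lam, rho_symm_of h, invGen_of, hk, h.symm]

theorem lam_symm_of {i j : α} (h : i ≠ j) (k : α) :
    (lam i j).symm (of k) = if k = i then (of j)⁻¹ * of i else of k := by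
  rw [MulEquiv.symm_apply_eq]
  split_ifs with hk
  · rw [_root_.map_mul, _root_.map_inv, lam_of h, lam_of h, if_pos rfl, if_neg h.symm,
      inv_mul_cancel_left, hk]
  · rw [lam_of h, if_neg hk]

/-- The automorphism that multiplies the generator `i` on both sides by the generator `j ≠ i`. -/
def twist (i j : α) : MulAut (FreeGroup α) := lam i j * rho i j

theorem twist_of {i j : α} (h : i ≠ j) (k : α) :
    twist i j (of k) = if k = i then of j * of i * of j else of k := by
  by_cases hk : k = i <;> simp [twist, rho_of h, lam_of h, hk, h.symm]

theorem twist_symm_of {i j : α} (h : i ≠ j) (k : α) :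
    (twist i j).symm (of k) = if k = i then (of j)⁻¹ * of i * (of j)⁻¹ else of k := by
  rw [MulEquiv.symm_apply_eq]
  split_ifs with hk
  · simp [twist_of h, h.symm, hk, mul_assoc]
  · rw [twist_of h, if_neg hk]

theorem commute_rho_lam {i j k : α} (hj : i ≠ j) (hk : i ≠ k) : Commute (rho i j) (lam i k) := by
  refine mulAut_ext fun x => ?_
  by_cases hx : x = i <;> simp [rho_of hj, lam_of hk, hx, hj.symm, hk.symm, mul_assoc]

theorem commute_rho_rho {i j k l : α} (hij : i ≠ j) (hkl : k ≠ l) (hik : i ≠ k) (hil : i ≠ l)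
    (hjk : j ≠ k) : Commute (rho i j) (rho k l) := by
  refine mulAut_ext fun x => ?_
  by_cases hx : x = i
  · subst hx; simp [rho_of hij, rho_of hkl, hik, hjk]
  by_cases hx' : x = k
  · subst hx'; simp [rho_of hij, rho_of hkl, hik.symm, hil.symm]
  simp [rho_of hij, rho_of hkl, hx, hx']

theorem commute_rho_lam' {i j k l : α} (hij : i ≠ j) (hkl : k ≠ l) (hik : i ≠ k) (hil : i ≠ l)
    (hjk : j ≠ k) : Commute (rho i j) (lam k l) := by
  refine mulAut_ext fun x => ?_
  by_cases hx : x = i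
  · subst hx; simp [rho_of hij, lam_of hkl, hik, hjk]
  by_cases hx' : x = k
  · subst hx'; simp [rho_of hij, lam_of hkl, hik.symm, hil.symm]
  simp [rho_of hij, lam_of hkl, hx, hx']

theorem commute_lam_lam {i j k l : α} (hij : i ≠ j) (hkl : k ≠ l) (hik : i ≠ k) (hil : i ≠ l)
    (hjk : j ≠ k) : Commute (lam i j) (lam k l) := by
  refine mulAut_ext fun x => ?_
  by_cases hx : x = i
  · subst hx; simp [lam_of hij, lam_of hkl, hik, hjk]
  by_cases hx' : x = k
  · subst hx'; simp [lam_of hij, lam_of hkl, hik.symm, hil.symm]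
  simp [lam_of hij, lam_of hkl, hx, hx']

theorem commute_invGen_rho {i j k : α} (hij : i ≠ j) (hki : k ≠ i) (hkj : k ≠ j) :
    Commute (invGen k) (rho i j) := by
  refine mulAut_ext fun x => ?_
  by_cases hx : x = i
  · subst hx; simp [rho_of hij, invGen_of, hki.symm, hkj.symm]
  by_cases hx' : x = k
  · subst hx'; simp [rho_of hij, invGen_of, hki]
  simp [rho_of hij, invGen_of, hx, hx']

theorem commute_invGen_invGen (i j : α) : Commute (invGen i) (invGen j) := by
  refine mulAut_ext fun x => ?_
  by_cases hij : i = j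
  · rw [hij]
  by_cases hx : x = i
  · subst hx; simp [invGen_of, hij]
  by_cases hx' : x = j
  · subst hx'; simp [invGen_of, hx]
  simp [invGen_of, hx, hx']

theorem commute_invGen_lam {i j k : α} (hij : i ≠ j) (hki : k ≠ i) (hkj : k ≠ j) :
    Commute (invGen k) (lam i j) := by
  have h := commute_invGen_invGen k i
  exact (h.mul_right (commute_invGen_rho hij hki hkj).inv_right).mul_right h

theorem commute_twist_twist {i l j : α} (hij : i ≠ j) (hlj : l ≠ j) (hil : i ≠ l) :
    Commute (twist i j) (twist l j) := by
  have h1 := commute_rho_rho hij hlj hil hij hlj.symm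
  have h2 := commute_rho_lam' hij hlj hil hij hlj.symm
  have h3 := commute_rho_lam' hlj hij hil.symm hlj hij.symm
  have h4 := commute_lam_lam hij hlj hil hij hlj.symm
  exact (h4.mul_right h3.symm).mul_left (h2.mul_right h1)

theorem commute_invGen_twist {i l j : α} (hlj : l ≠ j) (hij : i ≠ j) (hil : i ≠ l) :
    Commute (invGen i) (twist l j) :=
  (commute_invGen_lam hlj hil hij).mul_right (commute_invGen_rho hlj hil hij)

theorem invGen_mul_twist_sq {i j : α} (h : i ≠ j) : (invGen i * twist i j) ^ 2 = 1 := by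
  rw [sq]
  refine mulAut_ext fun x => ?_
  by_cases hx : x = i <;> simp [twist_of h, invGen_of, hx, h.symm, mul_assoc]

/-- The identity that separates left from right multiplication: on the left stands a conjugate of a
product of commuting twists, on the right a factor `lam i j * (rho i j)⁻¹`. -/
theorem conj_twist_mul_twist_inv {i l j : α} (hij : i ≠ j) (hlj : l ≠ j) (hil : i ≠ l) :
    (lam i l)⁻¹ * (twist l j * (twist i j)⁻¹) * lam i l =
      twist l j * (lam i j * (rho i j)⁻¹) := by
  rw [mul_assoc, inv_mul_eq_iff_eq_mul]
  refine mulAut_ext fun x => ?_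
  by_cases hx : x = i
  · subst hx
    simp [twist_of, twist_symm_of, lam_of, rho_symm_of, hij, hlj, hil, hil.symm, hij.symm,
      hlj.symm, mul_assoc]
  by_cases hx' : x = l
  · subst hx'
    simp [twist_of, twist_symm_of, lam_of, rho_symm_of, hij, hlj, hil, hil.symm, hij.symm,
      mul_assoc]
  simp [twist_of, twist_symm_of, lam_of, rho_symm_of, hij, hlj, hil, hx, hx']

theorem conj_invGen_lam {i j : α} : invGen i * (lam i j)⁻¹ * (invGen i)⁻¹ = rho i j := by
  simp [lam, mul_assoc, invGen_inv, invGen_mul_self]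
  rw [← mul_assoc, invGen_mul_self, one_mul]

theorem conj_invGen_rho {i j : α} : invGen i * (rho i j)⁻¹ * (invGen i)⁻¹ = lam i j := by
  rw [invGen_inv, lam]

theorem conj_invGen_rho_right {i j : α} (h : i ≠ j) :
    invGen j * (rho i j)⁻¹ * (invGen j)⁻¹ = rho i j := by
  rw [mul_inv_eq_iff_eq_mul]
  refine mulAut_ext fun x => ?_
  by_cases hx : x = i
  · subst hx; simp [rho_of h, rho_symm_of h, invGen_of, h]
  by_cases hx' : x = j
  · subst hx'; simp [rho_of h, rho_symm_of h, invGen_of, h.symm]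
  simp [rho_of h, rho_symm_of h, invGen_of, hx, hx']

theorem conj_invGen_lam_right {i j : α} (h : i ≠ j) :
    invGen j * (lam i j)⁻¹ * (invGen j)⁻¹ = lam i j := by
  rw [mul_inv_eq_iff_eq_mul]
  refine mulAut_ext fun x => ?_
  by_cases hx : x = i
  · subst hx; simp [lam_of h, lam_symm_of h, invGen_of, h]
  by_cases hx' : x = j
  · subst hx'; simp [lam_of h, lam_symm_of h, invGen_of, h.symm]
  simp [lam_of h, lam_symm_of h, invGen_of, hx, hx']

theorem conj_permAut_rho (σ : Equiv.Perm α) {i j : α} (h : i ≠ j) :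
    permAut α σ * rho i j * (permAut α σ)⁻¹ = rho (σ i) (σ j) := by
  rw [mul_inv_eq_iff_eq_mul]
  refine mulAut_ext fun x => ?_
  have h' := σ.injective.ne h
  by_cases hx : x = i <;> simp [rho_of h, rho_of h', permAut_of, hx]

theorem conj_permAut_invGen (σ : Equiv.Perm α) (i : α) :
    permAut α σ * invGen i * (permAut α σ)⁻¹ = invGen (σ i) := by
  rw [mul_inv_eq_iff_eq_mul]
  refine mulAut_ext fun x => ?_
  by_cases hx : x = i <;> simp [invGen_of, permAut_of, hx]

theorem conj_permAut_lam (σ : Equiv.Perm α) {i j : α} (h : i ≠ j) :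
    permAut α σ * lam i j * (permAut α σ)⁻¹ = lam (σ i) (σ j) := by
  rw [lam, lam, ← conj_permAut_invGen, ← conj_permAut_rho σ h]
  group

theorem conj_rho_rho {i k l : α} (hik : i ≠ k) (hil : i ≠ l) (hkl : k ≠ l) :
    rho k l * rho i k * (rho k l)⁻¹ = rho i k * rho i l ∧
      (rho k l)⁻¹ * rho i k * rho k l = rho i k * (rho i l)⁻¹ := by
  rw [mul_inv_eq_iff_eq_mul, mul_assoc (rho k l)⁻¹, inv_mul_eq_iff_eq_mul]
  constructor <;> refine mulAut_ext fun x => ?_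
  all_goals
    by_cases hx : x = i
    · subst hx; simp [rho_of, rho_symm_of, hik, hil, hkl, hik.symm, hil.symm, hkl.symm, mul_assoc]
    by_cases hx' : x = k
    · subst hx'; simp [rho_of, rho_symm_of, hik, hil, hkl, hik.symm, hil.symm]
    simp [rho_of, rho_symm_of, hik, hil, hkl, hx, hx']

theorem conj_lam_rho {i k l : α} (hik : i ≠ k) (hil : i ≠ l) (hkl : k ≠ l) :
    lam k l * rho i k * (lam k l)⁻¹ = rho i l * rho i k ∧
      (lam k l)⁻¹ * rho i k * lam k l = (rho i l)⁻¹ * rho i k := by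
  rw [mul_inv_eq_iff_eq_mul, mul_assoc (lam k l)⁻¹, inv_mul_eq_iff_eq_mul]
  constructor <;> refine mulAut_ext fun x => ?_
  all_goals
    by_cases hx : x = i
    · subst hx
      simp [rho_of, rho_symm_of, lam_of, hik, hil, hkl, hik.symm, hil.symm, hkl.symm, mul_assoc]
    by_cases hx' : x = k
    · subst hx'; simp [rho_of, rho_symm_of, lam_of, hik, hil, hkl, hik.symm, hil.symm]
    simp [rho_of, rho_symm_of, lam_of, hik, hil, hkl, hx, hx']

theorem conj_rho_lam {i k l : α} (hik : i ≠ k) (hil : i ≠ l) (hkl : k ≠ l) :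
    rho k l * lam i k * (rho k l)⁻¹ = lam i l * lam i k ∧
      (rho k l)⁻¹ * lam i k * rho k l = (lam i l)⁻¹ * lam i k := by
  rw [mul_inv_eq_iff_eq_mul, mul_assoc (rho k l)⁻¹, inv_mul_eq_iff_eq_mul]
  constructor <;> refine mulAut_ext fun x => ?_
  all_goals
    by_cases hx : x = i
    · subst hx
      simp [rho_of, lam_symm_of, lam_of, hik, hil, hkl, hik.symm, hil.symm, hkl.symm, mul_assoc]
    by_cases hx' : x = k
    · subst hx'; simp [rho_of, lam_symm_of, lam_of, hik, hil, hkl, hik.symm, hil.symm]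
    simp [rho_of, lam_symm_of, lam_of, hik, hil, hkl, hx, hx']

theorem conj_lam_lam {i k l : α} (hik : i ≠ k) (hil : i ≠ l) (hkl : k ≠ l) :
    lam k l * lam i k * (lam k l)⁻¹ = lam i k * lam i l ∧
      (lam k l)⁻¹ * lam i k * lam k l = lam i k * (lam i l)⁻¹ := by
  rw [mul_inv_eq_iff_eq_mul, mul_assoc (lam k l)⁻¹, inv_mul_eq_iff_eq_mul]
  constructor <;> refine mulAut_ext fun x => ?_
  all_goals
    by_cases hx : x = i
    · subst hx; simp [lam_of, lam_symm_of, hik, hil, hkl, hik.symm, hil.symm, hkl.symm, mul_assoc]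
    by_cases hx' : x = k
    · subst hx'; simp [lam_of, lam_symm_of, hik, hil, hkl, hik.symm, hil.symm]
    simp [lam_of, lam_symm_of, hik, hil, hkl, hx, hx']

end Identities

end FreeGroup

/-! ### Fixed points of larger and larger sets of transvections. -/

namespace FreeGroup

section FixedPoints

variable {α : Type*} [DecidableEq α] [Fintype α] {X : Type*} [MetricSpace X] [CompleteSpace X]
  [Nonempty X] [MulAction (MulAut (FreeGroup α)) X] [IsIsometricSMul (MulAut (FreeGroup α)) X]

omit [DecidableEq α] [Fintype α] [MetricSpace X] [CompleteSpace X] [Nonempty X]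
  [IsIsometricSMul (MulAut (FreeGroup α)) X] in
theorem elliptic_of_conj {S T : Set (MulAut (FreeGroup α))} (h : Elliptic X S)
    (g : MulAut (FreeGroup α)) (hT : ∀ t ∈ T, ∃ s ∈ Subgroup.closure S, g * s * g⁻¹ = t) :
    Elliptic X T := by
  refine h.conj g fun t ht => ?_
  obtain ⟨s, hs, rfl⟩ := hT t ht
  simpa [mul_assoc] using hs

omit [DecidableEq α] [Fintype α] [Nonempty X] in
theorem elliptic_mul_of_commute (hX : IsCAT0 X) {f g : MulAut (FreeGroup α)}
    (hf : Elliptic X {f}) (hg : Elliptic X {g}) (hfg : Commute f g) : Elliptic X {f * g} := by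
  have := hX.elliptic_union_of_commute hf hg (by rintro _ rfl _ rfl; exact hfg)
  refine this.of_subset_closure ?_
  rintro _ rfl
  exact mul_mem (Subgroup.subset_closure (Or.inl rfl)) (Subgroup.subset_closure (Or.inr rfl))

omit [DecidableEq α] [Fintype α] [MetricSpace X] [CompleteSpace X] [Nonempty X]
  [IsIsometricSMul (MulAut (FreeGroup α)) X] in
theorem elliptic_inv {f : MulAut (FreeGroup α)} (hf : Elliptic X {f}) : Elliptic X {f⁻¹} := by
  refine hf.of_subset_closure ?_
  rintro _ rfl
  exact inv_mem (Subgroup.subset_closure rfl)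

/-- The twist is a product of two involutions. For fixed `j` the remaining generators give n - 1
commuting pairs of involutions, and d < n - 1, so one pair has a common fixed point. Permutations
carry it to every `i`. -/
theorem elliptic_twist (hX : IsCAT0 X) {d : ℕ} (hd : HasCoveringDimLE X d)
    (hdn : d + 2 ≤ Fintype.card α) {i j : α} (hij : i ≠ j) : Elliptic X {twist i j} := by
  have hsq : ∀ g : MulAut (FreeGroup α), g ^ 2 = 1 → Elliptic X {g} := by
    intro g hg
    refine hX.elliptic_singleton_of_sq ⟨Classical.arbitrary X, ?_⟩
    rw [hg]
    rintro _ rfl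
    exact one_smul _ _
  let S : {i // i ≠ j} → Bool → Set (MulAut (FreeGroup α)) := fun i b =>
    if b then {invGen i.1 * twist i.1 j} else {invGen i.1}
  have hcard : Fintype.card {i // i ≠ j} = Fintype.card α - 1 := by
    simp
  obtain ⟨⟨l, hl⟩, h⟩ := hX.exists_elliptic_of_commuting_families hd (k := 1) (κ := Bool)
    (ι := {i // i ≠ j}) (by simp) (by rw [hcard]; omega) S (by
      rintro ⟨i, hi⟩ ⟨l, hl⟩ hil a b f hf g hg
      have hil' : i ≠ l := fun e => hil (Subtype.ext e)
      have c1 := commute_invGen_invGen i l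
      have c2 := commute_invGen_twist hl hi hil'
      have c3 := commute_invGen_twist hi hl hil'.symm
      have c4 := commute_twist_twist hi hl hil'
      cases a <;> cases b <;> simp only [S, Set.mem_singleton_iff, if_true, Bool.false_eq_true,
        if_false] at hf hg <;> subst hf <;> subst hg
      · exact c1
      · exact c1.mul_right c2
      · exact c1.mul_left c3.symm
      · exact (c1.mul_right c2).mul_left (c3.symm.mul_right c4)) (by
      rintro ⟨i, hi⟩ a
      have : Elliptic X (S ⟨i, hi⟩ (!a)) := by
        cases a
        · exact hsq _ (invGen_mul_twist_sq hi)
        · exact hsq _ (by rw [sq]; exact invGen_mul_self i)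
      refine this.mono (Set.iUnion₂_subset fun b hb => ?_)
      have : b = !a := by revert hb; cases a <;> cases b <;> simp
      rw [this])
  have h1 : Elliptic X {twist l j} := by
    refine h.of_subset_closure ?_
    rintro _ rfl
    have m1 : invGen l ∈ Subgroup.closure (⋃ a, S ⟨l, hl⟩ a) :=
      Subgroup.subset_closure (Set.mem_iUnion.mpr ⟨false, by simp [S]⟩)
    have m2 : invGen l * twist l j ∈ Subgroup.closure (⋃ a, S ⟨l, hl⟩ a) :=
      Subgroup.subset_closure (Set.mem_iUnion.mpr ⟨true, by simp [S]⟩)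
    simpa using mul_mem (inv_mem m1) m2
  refine elliptic_of_conj h1 (permAut α (Equiv.swap l i)) ?_
  rintro _ rfl
  refine ⟨_, Subgroup.subset_closure rfl, ?_⟩
  have e1 := conj_permAut_rho (Equiv.swap l i) hl
  have e2 := conj_permAut_lam (Equiv.swap l i) hl
  rw [Equiv.swap_apply_left, Equiv.swap_apply_of_ne_of_ne hl.symm hij.symm] at e1 e2
  rw [twist, twist, ← e1, ← e2]
  group

/-- A third generator `l` shows that `lam i j * (rho i j)⁻¹` is elliptic. It commutes with the twist
`lam i j * rho i j`, and their product is the square of `lam i j`. -/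
theorem elliptic_lam (hX : IsCAT0 X) {d : ℕ} (hd : HasCoveringDimLE X d)
    (hdn : d + 2 ≤ Fintype.card α) (hn : 3 ≤ Fintype.card α) {i j : α} (hij : i ≠ j) :
    Elliptic X {lam i j} := by
  obtain ⟨l, hl⟩ : ∃ l, l ∉ ({i, j} : Finset α) := by
    by_contra! h
    have := Finset.card_le_card (fun x _ => h x : (Finset.univ : Finset α) ⊆ {i, j})
    have := Finset.card_le_two (a := i) (b := j)
    rw [Finset.card_univ] at *
    omega
  simp only [Finset.mem_insert, Finset.mem_singleton, not_or] at hl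
  have hli : l ≠ i := hl.1
  have hlj : l ≠ j := hl.2
  have ti := elliptic_twist hX hd hdn hij
  have tl := elliptic_twist hX hd hdn hlj
  have hc := commute_twist_twist hlj hij hli
  have h1 := elliptic_mul_of_commute hX tl (elliptic_inv ti) hc.inv_right
  have h2 : Elliptic X {twist l j * (lam i j * (rho i j)⁻¹)} := by
    refine elliptic_of_conj h1 (lam i l)⁻¹ ?_
    rintro _ rfl
    exact ⟨_, Subgroup.subset_closure rfl, by
      rw [inv_inv]; exact conj_twist_mul_twist_inv hij hlj (Ne.symm hli)⟩
  have hcr : Commute (twist l j) (rho i j) :=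
    (commute_rho_lam' hij hlj (Ne.symm hli) hij hlj.symm).symm.mul_left
      (commute_rho_rho hlj hij hli hlj hij.symm)
  have hcl : Commute (twist l j) (lam i j) :=
    (commute_lam_lam hlj hij hli hlj hij.symm).mul_left
      (commute_rho_lam' hlj hij hli hlj hij.symm)
  have hcc : Commute (twist l j) (lam i j * (rho i j)⁻¹) := hcl.mul_right hcr.inv_right
  have h3 := elliptic_mul_of_commute hX (elliptic_inv tl) h2
    (((Commute.refl _).mul_right hcc).inv_left)
  rw [inv_mul_cancel_left] at h3
  have hrl : Commute (rho i j) (lam i j) := commute_rho_lam hij hij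
  have h4 := elliptic_mul_of_commute hX h3 ti
    ((((Commute.refl _).mul_right hrl.symm).mul_left
      ((hrl.mul_right (Commute.refl _)).inv_left)))
  refine hX.elliptic_singleton_of_sq ?_
  have e : lam i j * (rho i j)⁻¹ * twist i j = lam i j ^ 2 := by
    rw [twist, ← hrl.eq, mul_assoc, inv_mul_cancel_left, sq]
  rwa [e] at h4

/-- Induction on the size of `J`. Left and right transvections of each generator outside `J` are
mutually commuting families indexed by `J`, whose proper subfamilies are elliptic by induction. -/
theorem elliptic_rho_finset (hX : IsCAT0 X) {d : ℕ} (hd : HasCoveringDimLE X d)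
    (hdn : d + 2 ≤ Fintype.card α) (hn : 3 ≤ Fintype.card α) (J : Finset α) {i : α}
    (hi : i ∉ J) : Elliptic X {g | ∃ j ∈ J, g = rho i j} := by
  obtain ⟨m, hm⟩ : ∃ m, J.card = m := ⟨_, rfl⟩
  induction m generalizing J i with
  | zero =>
    rw [Finset.card_eq_zero] at hm
    subst hm
    exact ⟨Classical.arbitrary X, by simp⟩
  | succ k ih =>
    have toLam : ∀ (J : Finset α) (i : α), Elliptic X {g | ∃ j ∈ J, g = rho i j} →
        Elliptic X {g | ∃ j ∈ J, g = lam i j} := by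
      intro J i h
      refine elliptic_of_conj h (invGen i) ?_
      rintro _ ⟨j, hj, rfl⟩
      exact ⟨_, inv_mem (Subgroup.subset_closure ⟨j, hj, rfl⟩), conj_invGen_rho⟩
    have toRho : ∀ (J : Finset α) (i : α), Elliptic X {g | ∃ j ∈ J, g = lam i j} →
        Elliptic X {g | ∃ j ∈ J, g = rho i j} := by
      intro J i h
      refine elliptic_of_conj h (invGen i) ?_
      rintro _ ⟨j, hj, rfl⟩
      exact ⟨_, inv_mem (Subgroup.subset_closure ⟨j, hj, rfl⟩), conj_invGen_lam⟩
    rcases Nat.eq_zero_or_pos k with rfl | hk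
    · obtain ⟨j, rfl⟩ := Finset.card_eq_one.mp hm
      refine toRho _ _ ((elliptic_lam hX hd hdn hn (i := i) (j := j) (by simpa using hi)).mono ?_)
      rintro _ ⟨j', hj', rfl⟩
      rw [Finset.mem_singleton.mp hj']
      rfl
    have hne : ∀ {i j : α}, i ∉ J → j ∈ J → i ≠ j := fun hi hj e => hi (e ▸ hj)
    let S : {i // i ∉ J} × Bool → J → Set (MulAut (FreeGroup α)) := fun p j =>
      if p.2 then {rho (p.1 : α) (j : α)} else {lam (p.1 : α) (j : α)}
    have hcJ : J.card < Fintype.card α := Finset.card_lt_univ_of_notMem hi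
    have hcard : Fintype.card ({i // i ∉ J} × Bool) = (Fintype.card α - (k + 1)) * 2 := by
      rw [Fintype.card_prod, Fintype.card_bool, Fintype.card_subtype_compl, Fintype.card_coe, hm]
    obtain ⟨⟨⟨l, hl⟩, b⟩, h⟩ := hX.exists_elliptic_of_commuting_families hd (k := k) (κ := J)
      (ι := {i // i ∉ J} × Bool) (by rw [Fintype.card_coe, hm]) (by
        rw [hcard]
        -- With n = a + k + 2 the bound reads d ≤ a + k < 2(a + 1)k. This needs k ≥ 1, so singletons
        -- `J` were treated separately.
        obtain ⟨a, ha⟩ : ∃ a, Fintype.card α = a + 1 + (k + 1) :=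
          ⟨Fintype.card α - k - 2, by omega⟩
        obtain ⟨k', rfl⟩ : ∃ k', k = k' + 1 := ⟨k - 1, by omega⟩
        have e : Fintype.card α - (k' + 1 + 1) = a + 1 := by omega
        rw [e]
        have : d ≤ a + k' + 1 := by omega
        nlinarith [Nat.zero_le (a * k')]) S (by
        rintro ⟨⟨i, hi⟩, a⟩ ⟨⟨l, hl⟩, b⟩ hil ⟨j, hj⟩ ⟨j', hj'⟩ f hf g hg
        have hij := hne hi hj
        have hij' := hne hi hj'
        have hlj := hne hl hj
        have hlj' := hne hl hj'
        by_cases e : i = l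
        · subst e
          have hab : a ≠ b := fun e => hil (by rw [e])
          cases a <;> cases b <;> simp only [S, Set.mem_singleton_iff, if_true,
            Bool.false_eq_true, if_false] at hf hg <;> subst hf <;> subst hg
          · exact absurd rfl hab
          · exact (commute_rho_lam hij' hij).symm
          · exact commute_rho_lam hij hij'
          · exact absurd rfl hab
        · cases a <;> cases b <;> simp only [S, Set.mem_singleton_iff, if_true,
            Bool.false_eq_true, if_false] at hf hg <;> subst hf <;> subst hg
          · exact commute_lam_lam hij hlj' e hij' hlj.symm
          · exact (commute_rho_lam' hlj' hij (Ne.symm e) hlj hij'.symm).symm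
          · exact commute_rho_lam' hij hlj' e hij' hlj.symm
          · exact commute_rho_rho hij hlj' e hij' hlj.symm) (by
        rintro ⟨⟨i, hi⟩, a⟩ ⟨j, hj⟩
        have h1 := ih (J.erase j) (i := i) (fun h => hi (Finset.mem_of_mem_erase h))
          (by rw [Finset.card_erase_of_mem hj, hm, Nat.add_sub_cancel])
        cases a
        · refine (toLam _ _ h1).mono (Set.iUnion₂_subset fun b hb => ?_)
          rintro _ rfl
          exact ⟨b, Finset.mem_erase.mpr ⟨fun e => hb (Subtype.ext e), b.2⟩, rfl⟩
        · refine h1.mono (Set.iUnion₂_subset fun b hb => ?_)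
          rintro _ rfl
          exact ⟨b, Finset.mem_erase.mpr ⟨fun e => hb (Subtype.ext e), b.2⟩, rfl⟩)
    have h1 : Elliptic X {g | ∃ j ∈ J, g = rho l j} := by
      cases b
      · refine toRho _ _ (h.mono ?_)
        rintro _ ⟨j, hj, rfl⟩
        exact Set.mem_iUnion.mpr ⟨⟨j, hj⟩, rfl⟩
      · refine h.mono ?_
        rintro _ ⟨j, hj, rfl⟩
        exact Set.mem_iUnion.mpr ⟨⟨j, hj⟩, rfl⟩
    refine elliptic_of_conj h1 (permAut α (Equiv.swap l i)) ?_
    rintro _ ⟨j, hj, rfl⟩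
    refine ⟨_, Subgroup.subset_closure ⟨j, hj, rfl⟩, ?_⟩
    rw [conj_permAut_rho _ (hne hl hj), Equiv.swap_apply_left,
      Equiv.swap_apply_of_ne_of_ne (hne hl hj).symm (hne hi hj).symm]

/-- The transvections of the generator `i` by generators in `P`. -/
def transvections (i : α) (P : Set α) : Set (MulAut (FreeGroup α)) :=
  {g | ∃ j ∈ P, g = rho i j ∨ g = lam i j}

theorem elliptic_transvections (hX : IsCAT0 X) {d : ℕ} (hd : HasCoveringDimLE X d)
    (hdn : d + 2 ≤ Fintype.card α) (hn : 3 ≤ Fintype.card α) (P : Set α) {i : α}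
    (hi : i ∉ P) : Elliptic X (transvections i P) := by
  classical
  have h1 := elliptic_rho_finset hX hd hdn hn (Finset.univ.filter fun j => j ∈ P) (i := i)
    (by simpa using hi)
  have h2 : Elliptic X {g | ∃ j ∈ Finset.univ.filter fun j => j ∈ P, g = lam i j} := by
    refine elliptic_of_conj h1 (invGen i) ?_
    rintro _ ⟨j, hj, rfl⟩
    exact ⟨_, inv_mem (Subgroup.subset_closure ⟨j, hj, rfl⟩), conj_invGen_rho⟩
  refine (hX.elliptic_union_of_commute h1 h2 ?_).mono ?_
  · rintro _ ⟨j, hj, rfl⟩ _ ⟨k, hk, rfl⟩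
    simp only [Finset.mem_filter, Finset.mem_univ, true_and] at hj hk
    exact commute_rho_lam (fun e => hi (e ▸ hj)) (fun e => hi (e ▸ hk))
  · rintro _ ⟨j, hj, rfl | rfl⟩
    · exact Or.inl ⟨j, by simpa using hj, rfl⟩
    · exact Or.inr ⟨j, by simpa using hj, rfl⟩

omit [Fintype α] in
-- The normalization needed for `IsCAT0.elliptic_union`: conjugating by a transvection of k by l
-- changes only the transvections of i by k, and multiplies them by one of i by l.
theorem conj_mem_closure_transvections {i k l : α} (hik : i ≠ k) (hil : i ≠ l) (hkl : k ≠ l)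
    {P : Set α} (hi : i ∉ P) (hl : k ∈ P → l ∈ P) {a b : MulAut (FreeGroup α)}
    (ha : a ∈ transvections i P) (hb : b = rho k l ∨ b = lam k l) :
    b * a * b⁻¹ ∈ Subgroup.closure (transvections i P) ∧
      b⁻¹ * a * b ∈ Subgroup.closure (transvections i P) := by
  have hmem := Subgroup.subset_closure ha
  obtain ⟨j, hj, ha⟩ := ha
  have hij : i ≠ j := fun e => hi (e ▸ hj)
  by_cases hjk : j = k
  · subst hjk
    have r1 : rho i j ∈ Subgroup.closure (transvections i P) :=
      Subgroup.subset_closure ⟨j, hj, Or.inl rfl⟩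
    have r2 : lam i j ∈ Subgroup.closure (transvections i P) :=
      Subgroup.subset_closure ⟨j, hj, Or.inr rfl⟩
    have r3 : rho i l ∈ Subgroup.closure (transvections i P) :=
      Subgroup.subset_closure ⟨l, hl hj, Or.inl rfl⟩
    have r4 : lam i l ∈ Subgroup.closure (transvections i P) :=
      Subgroup.subset_closure ⟨l, hl hj, Or.inr rfl⟩
    rcases ha with rfl | rfl <;> rcases hb with rfl | rfl
    · rw [(conj_rho_rho hik hil hkl).1, (conj_rho_rho hik hil hkl).2]
      exact ⟨mul_mem r1 r3, mul_mem r1 (inv_mem r3)⟩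
    · rw [(conj_lam_rho hik hil hkl).1, (conj_lam_rho hik hil hkl).2]
      exact ⟨mul_mem r3 r1, mul_mem (inv_mem r3) r1⟩
    · rw [(conj_rho_lam hik hil hkl).1, (conj_rho_lam hik hil hkl).2]
      exact ⟨mul_mem r4 r2, mul_mem (inv_mem r4) r2⟩
    · rw [(conj_lam_lam hik hil hkl).1, (conj_lam_lam hik hil hkl).2]
      exact ⟨mul_mem r2 r4, mul_mem r2 (inv_mem r4)⟩
  · have hc : Commute a b := by
      rcases ha with rfl | rfl <;> rcases hb with rfl | rfl
      · exact commute_rho_rho hij hkl hik hil hjk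
      · exact commute_rho_lam' hij hkl hik hil hjk
      · exact (commute_rho_lam' hkl hij hik.symm (Ne.symm hjk) hil.symm).symm
      · exact commute_lam_lam hij hkl hik hil hjk
    rw [← hc.eq, mul_inv_cancel_right, mul_assoc, hc.eq, inv_mul_cancel_left]
    exact ⟨hmem, hmem⟩

/-- The transvections that are triangular with respect to an ordering of the generators have a
common fixed point. -/
theorem elliptic_triangular (hX : IsCAT0 X) {d : ℕ} (hd : HasCoveringDimLE X d)
    (hdn : d + 2 ≤ Fintype.card α) (hn : 3 ≤ Fintype.card α) (pos : α → ℕ)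
    (hpos : Function.Injective pos) :
    Elliptic X {g | ∃ i j, pos i < pos j ∧ (g = rho i j ∨ g = lam i j)} := by
  have key : ∀ k r, (∀ i, pos i < r + k) →
      Elliptic X {g | ∃ i j, r ≤ pos i ∧ pos i < pos j ∧ (g = rho i j ∨ g = lam i j)} := by
    intro k
    induction k with
    | zero =>
      intro r hr
      refine ⟨Classical.arbitrary X, ?_⟩
      rintro g ⟨i, _, h, -⟩
      have := hr i
      omega
    | succ k ih =>
      intro r hr
      have h1 := ih (r + 1) fun i => by have := hr i; omega
      by_cases hi : ∃ i, pos i = r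
      · obtain ⟨i, hi⟩ := hi
        have h2 := elliptic_transvections hX hd hdn hn {j | r < pos j} (i := i) (by simp [hi])
        -- Transvections among later generators normalize the group generated by the transvections
        -- of `i` by later ones.
        refine (hX.elliptic_union h2 h1 ?_).mono ?_
        · rintro b ⟨k, l, hrk, hkl, hb⟩ a ha
          exact conj_mem_closure_transvections (P := {j | r < pos j}) (i := i) (k := k) (l := l)
            (fun e => by subst e; omega) (fun e => by subst e; omega)
            (fun e => by subst e; omega) (by simp [hi]) (fun h => lt_trans h hkl) ha hb
        · rintro g ⟨k, l, hrk, hkl, hg⟩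
          rcases hrk.eq_or_lt with h | h
          · have : k = i := hpos (by rw [hi, h])
            subst this
            exact Or.inl ⟨l, by simpa [h] using hkl, hg⟩
          · exact Or.inr ⟨k, l, h, hkl, hg⟩
      · refine h1.mono ?_
        rintro g ⟨k, l, hrk, hkl, hg⟩
        exact ⟨k, l, lt_of_le_of_ne hrk fun e => hi ⟨k, e.symm⟩, hkl, hg⟩
  refine (key (∑ i, pos i + 1) 0 fun i => ?_).mono ?_
  · have := Finset.single_le_sum (f := pos) (fun _ _ => Nat.zero_le _) (Finset.mem_univ i)
    omega
  · rintro g ⟨i, j, hij, hg⟩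
    exact ⟨i, j, Nat.zero_le _, hij, hg⟩

variable (α) in
/-- The set of all transvections. -/
def allTransvections : Set (MulAut (FreeGroup α)) :=
  {g | ∃ i j, i ≠ j ∧ (g = rho i j ∨ g = lam i j)}

/-- If the transvections have a common fixed point, so has the whole automorphism group. -/
theorem elliptic_univ_of_transvections (hX : IsCAT0 X)
    (h : Elliptic X (allTransvections α)) :
    Elliptic X (Set.univ : Set (MulAut (FreeGroup α))) := by
  have hr : ∀ {i j : α}, i ≠ j → rho i j ∈ allTransvections α := fun h => ⟨_, _, h, Or.inl rfl⟩
  have hl : ∀ {i j : α}, i ≠ j → lam i j ∈ allTransvections α := fun h => ⟨_, _, h, Or.inr rfl⟩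
  have hI : Elliptic X (Set.range (invGen : α → MulAut (FreeGroup α))) := by
    rw [← Set.iUnion_singleton_eq_range]
    refine hX.elliptic_iUnion_of_commute (fun i => ?_) ?_
    · refine hX.elliptic_singleton_of_sq ⟨Classical.arbitrary X, ?_⟩
      rw [sq, invGen_mul_self]
      rintro _ rfl
      exact one_smul _ _
    · rintro i j - _ rfl _ rfl
      exact commute_invGen_invGen i j
  have h1 : Elliptic X (allTransvections α ∪ Set.range invGen) := by
    refine hX.elliptic_union h hI ?_
    rintro _ ⟨k, rfl⟩ a ha
    suffices invGen k * a * (invGen k)⁻¹ ∈ Subgroup.closure (allTransvections α) from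
      ⟨this, by simpa [invGen_inv] using this⟩
    obtain ⟨i, j, hij, ha⟩ := ha
    rw [← inv_mem_iff]
    have e : (invGen k * a * (invGen k)⁻¹)⁻¹ = invGen k * a⁻¹ * (invGen k)⁻¹ := by group
    rw [e]
    by_cases hki : k = i
    · subst hki
      rcases ha with rfl | rfl
      · rw [conj_invGen_rho]; exact Subgroup.subset_closure (hl hij)
      · rw [conj_invGen_lam]; exact Subgroup.subset_closure (hr hij)
    by_cases hkj : k = j
    · subst hkj
      rcases ha with rfl | rfl
      · rw [conj_invGen_rho_right hij]; exact Subgroup.subset_closure (hr hij)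
      · rw [conj_invGen_lam_right hij]; exact Subgroup.subset_closure (hl hij)
    rcases ha with rfl | rfl
    · rw [(commute_invGen_rho hij hki hkj).inv_right.eq, mul_inv_cancel_right]
      exact inv_mem (Subgroup.subset_closure (hr hij))
    · rw [(commute_invGen_lam hij hki hkj).inv_right.eq, mul_inv_cancel_right]
      exact inv_mem (Subgroup.subset_closure (hl hij))
  have : Finite (permAut α).range :=
    Finite.of_surjective _ (permAut α).rangeRestrict_surjective
  have hP := hX.elliptic_of_finite (permAut α).range
  have h2 := hX.elliptic_union h1 hP (by
    have key : ∀ σ, ∀ a ∈ allTransvections α ∪ Set.range invGen,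
        permAut α σ * a * (permAut α σ)⁻¹ ∈
          Subgroup.closure (allTransvections α ∪ Set.range invGen) := by
      rintro σ _ (⟨i, j, hij, rfl | rfl⟩ | ⟨i, rfl⟩)
      · rw [conj_permAut_rho σ hij]
        exact Subgroup.subset_closure (Or.inl (hr (σ.injective.ne hij)))
      · rw [conj_permAut_lam σ hij]
        exact Subgroup.subset_closure (Or.inl (hl (σ.injective.ne hij)))
      · rw [conj_permAut_invGen]
        exact Subgroup.subset_closure (Or.inr ⟨_, rfl⟩)
    rintro _ ⟨σ, rfl⟩ a ha
    exact ⟨key σ a ha, by simpa only [_root_.map_inv, inv_inv] using key σ⁻¹ a ha⟩)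
  refine h2.of_subset_closure ?_
  have h3 : nielsenSet α ⊆ allTransvections α ∪ Set.range invGen ∪ (permAut α).range := by
    rintro _ ((⟨i, j, hij, rfl⟩ | ⟨i, rfl⟩) | ⟨σ, rfl⟩)
    · exact Or.inl (Or.inl (hr hij))
    · exact Or.inl (Or.inr ⟨i, rfl⟩)
    · exact Or.inr ⟨σ, rfl⟩
  intro g _
  refine Subgroup.closure_mono h3 ?_
  rw [closure_nielsenSet]
  trivial

end FixedPoints

/-! ### Cyclic transvections and the final bootstrapping. -/

section Cyclic

variable {m : ℕ}

open scoped Fin.CommRing in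
/-- The transvections of each generator by the next one, in cyclic order, generate all of them. -/
theorem transvection_mem_closure_cyclic (hm : 2 ≤ m) {i j : Fin (m + 1)} (hij : i ≠ j) :
    rho i j ∈ Subgroup.closure {g | ∃ b : Fin (m + 1), g = rho b (b + 1) ∨ g = lam b (b + 1)} ∧
    lam i j ∈ Subgroup.closure {g | ∃ b : Fin (m + 1), g = rho b (b + 1) ∨ g = lam b (b + 1)} := by
  set H := Subgroup.closure {g | ∃ b : Fin (m + 1), g = rho b (b + 1) ∨ g = lam b (b + 1)}
  have hb1 : ∀ b : Fin (m + 1), rho b (b + 1) ∈ H := fun b =>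
    Subgroup.subset_closure ⟨b, Or.inl rfl⟩
  have hb2 : ∀ b : Fin (m + 1), lam b (b + 1) ∈ H := fun b =>
    Subgroup.subset_closure ⟨b, Or.inr rfl⟩
  have hcast : ∀ r : ℕ, 0 < r → r ≤ m → ((r : ℕ) : Fin (m + 1)) ≠ 0 := by
    intro r h0 hr h
    have := congrArg Fin.val h
    rw [Fin.val_natCast, Nat.mod_eq_of_lt (by omega)] at this
    simp at this
    omega
  have key : ∀ r : ℕ, 1 ≤ r → r ≤ m → ∀ i : Fin (m + 1),
      rho i (i + (r : Fin (m + 1))) ∈ H ∧ lam i (i + (r : Fin (m + 1))) ∈ H := by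
    intro r hr
    induction r, hr using Nat.le_induction with
    | base =>
      intro _ i
      rw [Nat.cast_one]
      exact ⟨hb1 i, hb2 i⟩
    | succ r hr ih =>
      intro hrm i
      obtain ⟨ih1, ih2⟩ := ih (by omega) i
      have e : i + ((r + 1 : ℕ) : Fin (m + 1)) = i + (r : Fin (m + 1)) + 1 := by
        rw [Nat.cast_add, Nat.cast_one, add_assoc]
      have hil : i ≠ i + (r : Fin (m + 1)) + 1 := by
        rw [← e]
        exact fun h => hcast (r + 1) (by omega) hrm (left_eq_add.mp h)
      rw [e]
      set k := i + (r : Fin (m + 1)) with hk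
      have hik : i ≠ k := fun h => hcast r hr (by omega) (left_eq_add.mp h)
      have hkl : k ≠ k + 1 := fun h => by
        have := hcast 1 one_pos (by omega)
        rw [Nat.cast_one] at this
        exact this (left_eq_add.mp h)
      have e1 := (conj_rho_rho hik hil hkl).1
      have e2 := (conj_rho_lam hik hil hkl).1
      constructor
      · rw [← inv_mul_eq_iff_eq_mul] at e1
        rw [← e1]
        exact mul_mem (inv_mem ih1) (mul_mem (mul_mem (hb1 k) ih1) (inv_mem (hb1 k)))
      · rw [← mul_inv_eq_iff_eq_mul] at e2
        rw [← e2]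
        exact mul_mem (mul_mem (mul_mem (hb1 k) ih2) (inv_mem (hb1 k))) (inv_mem ih2)
  have hsub : 1 ≤ ((j - i : Fin (m + 1)) : ℕ) := by
    rw [Nat.one_le_iff_ne_zero]
    intro h
    exact hij (sub_eq_zero.mp (Fin.ext h : j - i = 0)).symm
  have := key (j - i : Fin (m + 1)) hsub (Nat.lt_succ_iff.mp (j - i).2) i
  rwa [Fin.cast_val_eq_self, add_sub_cancel] at this

theorem elliptic_allTransvections {X : Type*} [MetricSpace X] [CompleteSpace X]
    [Nonempty X] [MulAction (MulAut (FreeGroup (Fin (m + 1)))) X]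
    [IsIsometricSMul (MulAut (FreeGroup (Fin (m + 1)))) X] (hX : IsCAT0 X) {d : ℕ}
    (hd : HasCoveringDimLE X d) (hdm : d + 1 ≤ m) (hm : 2 ≤ m) :
    Elliptic X (allTransvections (Fin (m + 1))) := by
  -- A single family of n = m + 1 sets, so the dimension only has to be below n - 1 and commutation
  -- is vacuous.
  obtain ⟨-, h⟩ := hX.exists_elliptic_of_commuting_families hd (k := m) (ι := Unit)
    (κ := Fin (m + 1)) (by simp) (by simp; omega)
    (fun _ b => {g | g = rho b (b + 1) ∨ g = lam b (b + 1)})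
    (fun i j hij => absurd rfl hij) (by
      intro _ a
      refine (elliptic_triangular hX hd (by simpa using hdm) (by simpa using hm)
        -- Start the cyclic order at a + 1: only the omitted pair (a, a + 1) wraps around, so all
        -- the others are triangular.
        (fun i => ((i - (a + 1) : Fin (m + 1)) : ℕ))
        (fun i j h => sub_left_injective (Fin.ext h))).mono
        (Set.iUnion₂_subset fun b hb g hg => ⟨b, b + 1, ?_, hg⟩)
      have e : b + 1 - (a + 1) = (b - (a + 1)) + 1 := by abel
      rw [e, ← Fin.lt_def, Fin.lt_add_one_iff, Fin.lt_last_iff_ne_last]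
      intro h
      refine hb ?_
      have h2 : b - (a + 1) + 1 = 0 := by rw [h]; exact Fin.last_add_one m
      have h3 : b - (a + 1) + 1 = b - a := by abel
      rw [h3] at h2
      exact sub_eq_zero.mp h2)
  refine h.of_subset_closure ?_
  have hset : (⋃ b : Fin (m + 1), {g | g = rho b (b + 1) ∨ g = lam b (b + 1)}) =
      {g | ∃ b : Fin (m + 1), g = rho b (b + 1) ∨ g = lam b (b + 1)} := by
    ext g; simp
  rw [hset]
  rintro _ ⟨i, j, hij, rfl | rfl⟩
  · exact (transvection_mem_closure_cyclic hm hij).1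
  · exact (transvection_mem_closure_cyclic hm hij).2

end Cyclic

/-- For `n ≥ 3`, the group `Aut(F_n)` has a global fixed point whenever it acts by isometries on a
complete CAT(0) space of dimension at most `n - 2`. -/
theorem exists_fixed_point {n d : ℕ} (hn : 3 ≤ n) (hdn : d + 2 ≤ n) {X : Type*} [MetricSpace X]
    [CompleteSpace X] [Nonempty X] [MulAction (MulAut (FreeGroup (Fin n))) X]
    [IsIsometricSMul (MulAut (FreeGroup (Fin n))) X] (hX : IsCAT0 X)
    (hd : HasCoveringDimLE X d) : ∃ x : X, ∀ g : MulAut (FreeGroup (Fin n)), g • x = x := by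
  obtain ⟨m, rfl⟩ : ∃ m, n = m + 1 := ⟨n - 1, by omega⟩
  obtain ⟨x, hx⟩ := elliptic_univ_of_transvections hX
    (elliptic_allTransvections (m := m) hX hd (by omega) (by omega))
  exact ⟨x, fun g => hx g trivial⟩

end FreeGroup

theorem corollary1p4 (n : ℕ) (hn : 4 ≤ n) :
    (∀ d : ℕ, d ≤ 2 * (n / 3) →
      ∀ (X : Type u) [MetricSpace X] [CompleteSpace X] [Nonempty X]
        [MulAction (MulAut (FreeGroup (Fin n))) X]
        [IsIsometricSMul (MulAut (FreeGroup (Fin n))) X],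
        IsCAT0 X → HasCoveringDim X d →
        ∃ x : X, ∀ g : MulAut (FreeGroup (Fin n)), g • x = x) ∧
    PropertyFA.{u} (MulAut (FreeGroup (Fin n))) (2 * (n / 3)) := by
  constructor
  · intro d hd X _ _ _ _ _ hX hdim
    -- The second `omega` is 2⌊n/3⌋ + 2 ≤ n, which uses n ≥ 4 and is false for n = 3.
    exact FreeGroup.exists_fixed_point (d := d) (by omega) (by omega) hX hdim.1
  · intro X _ _ _ _ _ hX hdim
    obtain ⟨x, hx⟩ := FreeGroup.exists_fixed_point (n := n) (d := 2 * (n / 3)) (by omega)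
      (by omega) hX hdim.1
    exact ⟨x, fun g _ => hx g⟩
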